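/- Let $M$ be a smooth manifold of dimension $n\ge 3$. Let $F\colon TM\to[0,\infty)$ be a Finsler metric, possibly singular along one direction in each tangent space: $F$ is continuous, $F(tv)=tF(v)$ for $t>0$, $F$ is of class $C^2$ on the complement of the zero section, every nonzero tangent vector at $x$ outside some line in $T_xM$ is regular, i.e. has a neighbourhood in $TM$ on which $F$ is $C^\infty$ (if $F$ is $C^\infty$ on the complement of the zero section, every nonzero vector is regular), and, with $E=\tfrac12F^2$, the Hessian $g_{ij}=\partial^2E/\partial y^i\partial y^j$ is positive definite at all nonzero vectors. In induced coordinates $(x,y)$ of $TM$ let $$G^l=\tfrac12 g^{lm}\Big(y^k\frac{\partial^2E}{\partial y^m\partial x^k}-\frac{\partial E}{\partial x^m}\Big),\qquad P^l_{ijk}=-\frac{\partial^3G^l}{\partial y^i\partial y^j\partial y^k}$$ (the mixed curvature of the Berwald connection). Let $\alpha\colon M\to\mathbb R$ be smooth with partial derivatives $\alpha_l$, let $p\in M$ with $d_p\alpha\ne0$, and let $\tilde P^l_{ijk}$ be the mixed curvature of $\tilde F=e^{\alpha}F$. Suppose that 1. the indicatrix $\{v\in T_pM: F(v)=1\}$,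 with the Riemannian metric induced by $g_{ij}$, has positive sectional curvature at its regular points; 2. $\tilde P^l_{ijk}\alpha_l=P^l_{ijk}\alpha_l$ at all regular tangent vectors of $M$. Then $p$ has an open neighbourhood $U$ such that at least one of the following holds: - $F=e^{\rho}F_0$ on $TU$, where $\rho$ is a smooth function on $U$ and $F_0$ is a Finsleroid-Finsler metric, that is, $$F_0=e^{G\Phi/2}\sqrt{b^2+gqb+q^2},\quad b=b_i(x)y^i,\quad q=\sqrt{a_{ij}(x)y^iy^j-b^2},\quad h=\sqrt{1-g^2/4},\quad G=g/h,$$ with a smooth Riemannian metric $a_{ij}$ on $U$, a smooth $1$-form $b_i$ on $U$ with $a^{ij}b_ib_j=1$, a smooth function $g=g(x)$ with $-2<g<2$, and $$\Phi=\pm\frac{\pi}{2}+\arctan\frac G2-\arctan\frac{q+\frac g2b}{hb}\quad\text{for } \pm b>0,\qquad \Phi=\arctan\frac G2\quad\text{for } b=0;$$ - $F$ is Riemannian on $U$, that is, $F(v)=\sqrt{a(v,v)}$ on $TU$ for a smooth Riemannian metric $a$ on $U$. -/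

import Mathlib

open scoped Manifold ContDiff Topology

noncomputable section

namespace FinslerConformal

/-- The coordinate space `ℝⁿ`. -/
abbrev Coord (n : ℕ) : Type := EuclideanSpace ℝ (Fin n)

/-- The `i`-th partial derivative of a real function on `ℝⁿ`. -/
def pd {n : ℕ} (i : Fin n) (f : Coord n → ℝ) (x : Coord n) : ℝ :=
  fderiv ℝ f x (EuclideanSpace.single i 1)

/-! ### Riemannian sectional curvature in coordinates -/

/-- Christoffel symbols `Γᵏᵢⱼ` of a Riemannian metric `h` given by its matrix in coordinates. -/
def christoffel {m : ℕ} (h : Coord m → Matrix (Fin m) (Fin m) ℝ) (k i j : Fin m)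
    (u : Coord m) : ℝ :=
  (1 / 2) * ∑ l, (h u)⁻¹ k l *
    (pd i (fun u' => h u' j l) u + pd j (fun u' => h u' i l) u - pd l (fun u' => h u' i j) u)

/-- Components of the curvature tensor: `R(∂ᵢ, ∂ⱼ)∂ₖ = Rˡₖᵢⱼ ∂ₗ`. -/
def riemannCurv {m : ℕ} (h : Coord m → Matrix (Fin m) (Fin m) ℝ) (l k i j : Fin m)
    (u : Coord m) : ℝ :=
  pd i (christoffel h l j k) u - pd j (christoffel h l i k) u
    + ∑ r, (christoffel h l i r u * christoffel h r j k u
      - christoffel h l j r u * christoffel h r i k u)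

/-- The value `h_u(a, b)`. -/
def metricVal {m : ℕ} (h : Coord m → Matrix (Fin m) (Fin m) ℝ) (u a b : Coord m) : ℝ :=
  ∑ i, ∑ j, h u i j * a i * b j

/-- The sectional curvature `h(R(a,b)b, a) / (h(a,a) h(b,b) - h(a,b)²)` of the plane spanned by
two linearly independent vectors `a, b` at `u`. -/
def sectionalCurv {m : ℕ} (h : Coord m → Matrix (Fin m) (Fin m) ℝ) (u a b : Coord m) : ℝ :=
  (∑ i, ∑ j, ∑ k, ∑ l, ∑ p, h u p l * riemannCurv h l k i j u * a i * b j * b k * a p) /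
    (metricVal h u a a * metricVal h u b b - metricVal h u a b ^ 2)

/-! ### Finsler quantities in induced coordinates `(x, y)` on the tangent bundle -/

/-- The energy `E = F² / 2`. -/
def energy {n : ℕ} (f : Coord n → Coord n → ℝ) (x y : Coord n) : ℝ := (1 / 2) * f x y ^ 2

/-- The Riemann-Finsler metric `gᵢⱼ = ∂²E / ∂yⁱ∂yʲ`. -/
def gMat {n : ℕ} (f : Coord n → Coord n → ℝ) (x y : Coord n) : Matrix (Fin n) (Fin n) ℝ :=
  Matrix.of fun i j => pd i (fun y' => pd j (fun y'' => energy f x y'') y') y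

/-- The geodesic spray coefficients
`Gˡ = (1/2) gˡᵐ (yᵏ ∂²E/∂yᵐ∂xᵏ - ∂E/∂xᵐ)`. -/
def spray {n : ℕ} (f : Coord n → Coord n → ℝ) (l : Fin n) (x y : Coord n) : ℝ :=
  (1 / 2) * ∑ m, (gMat f x y)⁻¹ l m *
    (∑ k, y k * pd m (fun y' => pd k (fun x' => energy f x' y') x) y
      - pd m (fun x' => energy f x' y) x)

/-- The mixed curvature of the Berwald connection
`Pˡᵢⱼₖ = - ∂³Gˡ / ∂yᵏ∂yʲ∂yⁱ`. -/
def berwaldP {n : ℕ} (f : Coord n → Coord n → ℝ) (l i j k : Fin n) (x y : Coord n) : ℝ :=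
  - pd k (fun y₁ => pd j (fun y₂ => pd i (fun y₃ => spray f l x y₃) y₂) y₁) y

/-! ### Finsler metrics on manifolds -/

section Manifold

variable {n : ℕ} {M : Type*} [TopologicalSpace M] [ChartedSpace (Coord n) M]

/-- The tangent vector `yⁱ ∂/∂uⁱ` at the point with coordinates `x` in the chart `e`. -/
def vec (e : OpenPartialHomeomorph M (Coord n)) (x y : Coord n) : TangentBundle (𝓡 n) M :=
  ⟨e.symm x, (mfderiv (𝓡 n) (𝓡 n) e.symm x : Coord n →L[ℝ] TangentSpace (𝓡 n) (e.symm x)) y⟩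

/-- The coordinate expression `F(x, y)` of a function on the tangent bundle. -/
def inChart (F : TangentBundle (𝓡 n) M → ℝ) (e : OpenPartialHomeomorph M (Coord n))
    (x y : Coord n) : ℝ :=
  F (vec e x y)

/-- The partial derivative `αₗ = ∂α/∂uˡ` in the chart `e`. -/
def partialAt (α : M → ℝ) (e : OpenPartialHomeomorph M (Coord n)) (l : Fin n) (x : Coord n) : ℝ :=
  pd l (fun x' => α (e.symm x')) x

/-- The conformal change `e^α F`. -/
def conformalChange (α : M → ℝ) (F : TangentBundle (𝓡 n) M → ℝ) :
    TangentBundle (𝓡 n) M → ℝ :=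
  fun v => Real.exp (α v.proj) * F v

variable [IsManifold (𝓡 n) ∞ M]

/-- A nonzero tangent vector is regular for `F` if `F` is smooth on a neighbourhood of it in the
tangent bundle. -/
def IsRegularVec (F : TangentBundle (𝓡 n) M → ℝ) (v : TangentBundle (𝓡 n) M) : Prop :=
  v.snd ≠ 0 ∧ ∀ᶠ w in 𝓝 v, ContMDiffAt (𝓡 n).tangent 𝓘(ℝ, ℝ) ∞ F w

/-- Finsler metrics, possibly singular along one direction in each tangent space: `F` is of class
`C²` off the zero section and smooth off the zero section and a line in each tangent space.
Metrics that are smooth on the whole complement of the zero section are the case in which every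
nonzero vector is regular. -/
structure IsFinsler (F : TangentBundle (𝓡 n) M → ℝ) : Prop where
  continuous : Continuous F
  nonneg : ∀ v, 0 ≤ F v
  contMDiffOn_two : ContMDiffOn (𝓡 n).tangent 𝓘(ℝ, ℝ) 2 F {v | v.snd ≠ 0}
  regular : ∀ x : M, ∃ d : TangentSpace (𝓡 n) x, ∀ v : TangentSpace (𝓡 n) x,
    v ∉ Submodule.span ℝ {d} → IsRegularVec F ⟨x, v⟩
  homogeneous : ∀ (x : M) (v : TangentSpace (𝓡 n) x) (t : ℝ), 0 < t →
    F ⟨x, t • v⟩ = t * F ⟨x, v⟩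
  posDef : ∀ e ∈ IsManifold.maximalAtlas (𝓡 n) ∞ M, ∀ x ∈ e.target, ∀ y : Coord n, y ≠ 0 →
    (gMat (inChart F e) x y).PosDef

/-- The Riemannian metric induced by `gᵢⱼ` on the indicatrix, in a local parametrization `φ`. -/
def inducedMetric {m : ℕ} (f : Coord n → Coord n → ℝ) (x : Coord n) (φ : Coord m → Coord n)
    (u : Coord m) : Matrix (Fin m) (Fin m) ℝ :=
  Matrix.of fun a b => ∑ i, ∑ j,
    gMat f x (φ u) i j * pd a (fun u' => φ u' i) u * pd b (fun u' => φ u' j) u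

/-- The indicatrix `{v ∈ TₚM | F v = 1}`, with the Riemannian metric induced by `gᵢⱼ`, has positive
sectional curvature (at its regular points): in every chart of `M` around `p` and every smooth
local parametrization of the regular part of the indicatrix, all sectional curvatures of the
induced metric are positive. -/
def IndicatrixPosCurvAt (F : TangentBundle (𝓡 n) M → ℝ) (p : M) : Prop :=
  ∀ e ∈ IsManifold.maximalAtlas (𝓡 n) ∞ M, p ∈ e.source →
    ∀ (W : Set (Coord (n - 1))) (φ : Coord (n - 1) → Coord n), IsOpen W → ContDiffOn ℝ ∞ φ W →
      (∀ u ∈ W, Function.Injective (fderiv ℝ φ u)) →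
      (∀ u ∈ W, inChart F e (e p) (φ u) = 1 ∧ IsRegularVec F (vec e (e p) (φ u))) →
      ∀ u ∈ W, ∀ a b : Coord (n - 1), LinearIndependent ℝ ![a, b] →
        0 < sectionalCurv (inducedMetric (inChart F e) (e p) φ) u a b

/-- `P̃ˡᵢⱼₖ αₗ = Pˡᵢⱼₖ αₗ` for the conformal change `F̃ = e^α F`, at all regular vectors and in all
charts. -/
def ContractedBerwaldInvariant (F : TangentBundle (𝓡 n) M → ℝ) (α : M → ℝ) : Prop :=
  ∀ e ∈ IsManifold.maximalAtlas (𝓡 n) ∞ M, ∀ x ∈ e.target, ∀ y : Coord n,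
    IsRegularVec F (vec e x y) → ∀ i j k : Fin n,
      ∑ l, berwaldP (inChart (conformalChange α F) e) l i j k x y * partialAt α e l x
        = ∑ l, berwaldP (inChart F e) l i j k x y * partialAt α e l x

/-- A smooth Riemannian metric on the open set `U`; smoothness is that of the function
`aᵢⱼ(x) yⁱ yʲ` on the tangent bundle of `U`. -/
structure IsRiemannianOn (U : Set M) (a : ∀ x : M, LinearMap.BilinForm ℝ (TangentSpace (𝓡 n) x)) :
    Prop where
  symm : ∀ x ∈ U, ∀ v w, a x v w = a x w v
  pos : ∀ x ∈ U, ∀ v, v ≠ 0 → 0 < a x v v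
  smooth : ContMDiffOn (𝓡 n).tangent 𝓘(ℝ, ℝ) ∞
    (fun v : TangentBundle (𝓡 n) M => a v.proj v.snd v.snd) {v | v.proj ∈ U}

/-- `F` is a Riemannian metric function on a neighbourhood of `p`. -/
def LocallyRiemannianAt (F : TangentBundle (𝓡 n) M → ℝ) (p : M) : Prop :=
  ∃ U : Set M, IsOpen U ∧ p ∈ U ∧ ∃ a : ∀ x : M, LinearMap.BilinForm ℝ (TangentSpace (𝓡 n) x),
    IsRiemannianOn U a ∧
    ∀ v : TangentBundle (𝓡 n) M, v.proj ∈ U → F v = Real.sqrt (a v.proj v.snd v.snd)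

/-- The angle `Φ` of the Finsleroid; at `b = 0` it is the common limit of the two branches. -/
def finsleroidAngle (g b q : ℝ) : ℝ :=
  let h := Real.sqrt (1 - g ^ 2 / 4)
  let G := g / h
  if 0 < b then Real.pi / 2 + Real.arctan (G / 2) - Real.arctan ((q + g / 2 * b) / (h * b))
  else if b < 0 then
    - (Real.pi / 2) + Real.arctan (G / 2) - Real.arctan ((q + g / 2 * b) / (h * b))
  else Real.arctan (G / 2)

/-- `e^{GΦ/2} √(b² + g q b + q²)` with `h = √(1 - g²/4)`, `G = g / h`. -/
def finsleroidFun (g b q : ℝ) : ℝ :=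
  Real.exp (g / Real.sqrt (1 - g ^ 2 / 4) * finsleroidAngle g b q / 2)
    * Real.sqrt (b ^ 2 + g * q * b + q ^ 2)

/-- `F₀` is over the open set `U` a Finsleroid-Finsler metric: it is built from a smooth
Riemannian metric `a`, a smooth 1-form `b` of unit length with respect to `a` (`w` is the vector
dual to `b`) and a smooth function `g` with values in `(-2, 2)`, with
`q = √(a(v,v) - b(v)²)`. -/
def IsFinsleroidOn (U : Set M) (F₀ : TangentBundle (𝓡 n) M → ℝ) : Prop :=
  ∃ (a : ∀ x : M, LinearMap.BilinForm ℝ (TangentSpace (𝓡 n) x))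
    (b : ∀ x : M, Module.Dual ℝ (TangentSpace (𝓡 n) x)) (g : M → ℝ),
    IsRiemannianOn U a ∧
    ContMDiffOn (𝓡 n).tangent 𝓘(ℝ, ℝ) ∞
      (fun v : TangentBundle (𝓡 n) M => b v.proj v.snd) {v | v.proj ∈ U} ∧
    (∀ x ∈ U, ∃ w : TangentSpace (𝓡 n) x, (∀ v, a x w v = b x v) ∧ b x w = 1) ∧
    ContMDiffOn (𝓡 n) 𝓘(ℝ, ℝ) ∞ g U ∧
    (∀ x ∈ U, -2 < g x ∧ g x < 2) ∧
    ∀ v : TangentBundle (𝓡 n) M, v.proj ∈ U →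
      F₀ v = finsleroidFun (g v.proj) (b v.proj v.snd)
        (Real.sqrt (a v.proj v.snd v.snd - b v.proj v.snd ^ 2))

/-- `F` is conformal to a Finsleroid-Finsler metric on a neighbourhood of `p`. -/
def LocallyConformalToFinsleroidAt (F : TangentBundle (𝓡 n) M → ℝ) (p : M) : Prop :=
  ∃ U : Set M, IsOpen U ∧ p ∈ U ∧ ∃ (ρ : M → ℝ) (F₀ : TangentBundle (𝓡 n) M → ℝ),
    ContMDiffOn (𝓡 n) 𝓘(ℝ, ℝ) ∞ ρ U ∧ IsFinsleroidOn U F₀ ∧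
    ∀ v : TangentBundle (𝓡 n) M, v.proj ∈ U → F v = conformalChange ρ F₀ v

end Manifold

end FinslerConformal

end

/-! Passing from `F` to `e^α F` changes the spray contracted with `dα` by `½ F² |dα|² - (dα)²`,
where `|dα|` is the length for the fundamental tensor. Invariance of the contracted mixed curvature
therefore says that on each tangent space `F² |dα|²` has vanishing third derivatives at the regular
vectors, so that it is a quadratic form `A(y, y)`. A Minkowski norm with this property is compared,
by a maximum principle, with the Finsleroids that agree with it on the axis of `A` and `dα` and are
stretched transversally by `μ > 1` or `μ < 1`; letting `μ → 1` shows that it is a Finsleroid. Its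
parameters are read off at vectors annihilated by `dα`; for `n ≥ 3` these can be chosen regular,
and the parameters then depend smoothly on the base point. Riemannian metrics are Finsleroids with
`g = 0`. -/

noncomputable section

open Set Filter
open scoped Matrix

namespace FinslerConformal

/-! ### Finsleroid functions -/

section Finsleroid

variable {g : ℝ}

/-- The complex number `h q + i (b + g q / 2)`, `h = √(1 - g² / 4)`, attached to the arguments of
the Finsleroid function: for `q ≥ 0` its argument is the angle `Φ` and its norm is
`√(b² + g q b + q²)`. -/
def finsleroidComplex (g b q : ℝ) : ℂ := ⟨√(1 - g ^ 2 / 4) * q, b + g / 2 * q⟩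

/-- The quadratic form `b² + g q b + q²` of the Finsleroid function. -/
def finsleroidQuad (g b q : ℝ) : ℝ := b ^ 2 + g * q * b + q ^ 2

theorem one_sub_sq_div_four_pos (hg : g ∈ Ioo (-2) 2) : 0 < 1 - g ^ 2 / 4 := by
  nlinarith [hg.1, hg.2]

theorem sqrt_one_sub_sq_div_four_pos (hg : g ∈ Ioo (-2) 2) : 0 < √(1 - g ^ 2 / 4) :=
  Real.sqrt_pos.2 (one_sub_sq_div_four_pos hg)

theorem sq_sqrt_one_sub_sq_div_four (hg : g ∈ Ioo (-2) 2) :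
    √(1 - g ^ 2 / 4) ^ 2 = 1 - g ^ 2 / 4 :=
  Real.sq_sqrt (one_sub_sq_div_four_pos hg).le

theorem normSq_finsleroidComplex (hg : g ∈ Ioo (-2) 2) (b q : ℝ) :
    Complex.normSq (finsleroidComplex g b q) = finsleroidQuad g b q := by
  simp only [finsleroidComplex, finsleroidQuad, Complex.normSq_mk]
  linear_combination q ^ 2 * sq_sqrt_one_sub_sq_div_four hg

theorem finsleroidComplex_ne_zero (hg : g ∈ Ioo (-2) 2) {b q : ℝ} (h : b ≠ 0 ∨ q ≠ 0) :
    finsleroidComplex g b q ≠ 0 := by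
  intro hz
  have hq : q = 0 :=
    (mul_eq_zero.1 (congrArg Complex.re hz)).resolve_left (sqrt_one_sub_sq_div_four_pos hg).ne'
  have hb : b + g / 2 * q = 0 := congrArg Complex.im hz
  simp_all

theorem finsleroidQuad_pos (hg : g ∈ Ioo (-2) 2) {b q : ℝ} (h : b ≠ 0 ∨ q ≠ 0) :
    0 < finsleroidQuad g b q := by
  rw [← normSq_finsleroidComplex hg]
  exact Complex.normSq_pos.2 (finsleroidComplex_ne_zero hg h)

theorem finsleroidComplex_mem_slitPlane (hg : g ∈ Ioo (-2) 2) {b q : ℝ} (hq : 0 ≤ q)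
    (h : b ≠ 0 ∨ q ≠ 0) : finsleroidComplex g b q ∈ Complex.slitPlane := by
  rcases hq.eq_or_lt with rfl | hq
  · exact .inr (by simpa [finsleroidComplex] using h)
  · exact .inl (mul_pos (sqrt_one_sub_sq_div_four_pos hg) hq)

theorem arg_eq_arctan_of_re_pos {z : ℂ} (hz : 0 < z.re) :
    z.arg = Real.arctan (z.im / z.re) := by
  have h := abs_lt.1 (Complex.abs_arg_lt_pi_div_two_iff.2 (.inl hz))
  rw [← Complex.tan_arg, Real.arctan_tan h.1 h.2]

theorem finsleroidAngle_neg_neg (g b q : ℝ) :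
    finsleroidAngle (-g) (-b) q = -finsleroidAngle g b q := by
  have hdiv : (q + -g / 2 * -b) / (√(1 - g ^ 2 / 4) * -b)
      = -((q + g / 2 * b) / (√(1 - g ^ 2 / 4) * b)) := by
    rw [show q + -g / 2 * -b = q + g / 2 * b by ring, mul_neg, div_neg]
  simp only [finsleroidAngle, neg_sq, Left.neg_pos_iff, Left.neg_neg_iff, hdiv]
  simp only [neg_div, Real.arctan_neg]
  rcases lt_trichotomy b 0 with hb | rfl | hb
  · simp only [hb, hb.not_gt, if_true, if_false]; ring
  · simp
  · simp only [hb, hb.not_gt, if_true, if_false]; ring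

theorem arg_finsleroidComplex_neg_neg {b q : ℝ} (hq : 0 ≤ q) :
    (finsleroidComplex (-g) (-b) q).arg = -(finsleroidComplex g b q).arg := by
  have hconj : finsleroidComplex (-g) (-b) q = (starRingEnd ℂ) (finsleroidComplex g b q) := by
    apply Complex.ext
    · simp [finsleroidComplex]
    · simp only [finsleroidComplex, Complex.conj_im]; ring
  have hre : 0 ≤ (finsleroidComplex g b q).re := mul_nonneg (Real.sqrt_nonneg _) hq
  rw [hconj, Complex.arg_conj, if_neg fun h => (Complex.arg_eq_pi_iff.1 h).1.not_ge hre]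

-- With `h² + g² / 4 = 1` one has `h q + i (b + g q / 2) = i (h + i g / 2) (h b - i (q + g b / 2))`;
-- the arguments of the three factors are the three terms of `Φ`.
theorem finsleroidAngle_eq_arg_of_pos (hg : g ∈ Ioo (-2) 2) {b q : ℝ} (hb : 0 < b) (hq : 0 ≤ q) :
    finsleroidAngle g b q = (finsleroidComplex g b q).arg := by
  have hh := sqrt_one_sub_sq_div_four_pos hg
  have hsq := sq_sqrt_one_sub_sq_div_four hg
  simp only [finsleroidAngle, hb, if_true, finsleroidComplex]
  set h := √(1 - g ^ 2 / 4)
  let u : ℂ := ⟨h, g / 2⟩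
  let w : ℂ := ⟨h * b, -(q + g / 2 * b)⟩
  have hw_re : 0 < w.re := mul_pos hh hb
  have hu : u.arg = Real.arctan (g / h / 2) := by
    rw [arg_eq_arctan_of_re_pos hh, div_right_comm]
  have hw : w.arg = -Real.arctan ((q + g / 2 * b) / (h * b)) := by
    rw [arg_eq_arctan_of_re_pos hw_re, ← Real.arctan_neg, neg_div]
  have hu0 : u ≠ 0 := fun hz => hh.ne' (congrArg Complex.re hz)
  have hw0 : w ≠ 0 := fun hz => hw_re.ne' (congrArg Complex.re hz)
  have hle : u.arg + w.arg ≤ 0 := by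
    have : g / h / 2 ≤ (q + g / 2 * b) / (h * b) := by
      rw [div_div, div_le_div_iff₀ (by positivity) (by positivity)]
      nlinarith [mul_nonneg hh.le hq]
    rw [hu, hw, ← sub_eq_add_neg, sub_nonpos]
    exact Real.arctan_strictMono.monotone this
  have hlt : -Real.pi < u.arg + w.arg := by
    have := Real.neg_pi_div_two_lt_arctan (g / h / 2)
    have := Real.arctan_lt_pi_div_two ((q + g / 2 * b) / (h * b))
    rw [hu, hw]; linarith
  have huw : (u * w).arg = u.arg + w.arg :=
    Complex.arg_mul hu0 hw0 ⟨hlt, hle.trans Real.pi_pos.le⟩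
  have hfactor : (⟨h * q, b + g / 2 * q⟩ : ℂ) = Complex.I * (u * w) := by
    apply Complex.ext
    · simp [u, w]; ring
    · simp [u, w]; linear_combination (-b) * hsq
  rw [hfactor, Complex.arg_mul Complex.I_ne_zero (mul_ne_zero hu0 hw0), Complex.arg_I, huw, hu, hw]
  · ring
  · rw [Complex.arg_I, huw]
    constructor <;> linarith [Real.pi_pos]

theorem finsleroidAngle_eq_arg (hg : g ∈ Ioo (-2) 2) {b q : ℝ} (hq : 0 ≤ q)
    (h : b ≠ 0 ∨ q ≠ 0) : finsleroidAngle g b q = (finsleroidComplex g b q).arg := by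
  rcases lt_trichotomy b 0 with hb | rfl | hb
  · have hg' : -g ∈ Ioo (-2) 2 := ⟨by linarith [hg.2], by linarith [hg.1]⟩
    have := finsleroidAngle_eq_arg_of_pos hg' (neg_pos.2 hb) hq
    rwa [finsleroidAngle_neg_neg, arg_finsleroidComplex_neg_neg hq, neg_inj] at this
  · have hq' : 0 < q := hq.lt_of_ne' (by simpa using h)
    have hh := sqrt_one_sub_sq_div_four_pos hg
    rw [arg_eq_arctan_of_re_pos (mul_pos hh hq')]
    simp only [finsleroidAngle, finsleroidComplex, lt_irrefl, if_false, zero_add]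
    rw [mul_div_mul_right _ _ hq'.ne', div_right_comm]
  · exact finsleroidAngle_eq_arg_of_pos hg hb hq

theorem finsleroidFun_eq_exp_arg_mul_norm (hg : g ∈ Ioo (-2) 2) {b q : ℝ} (hq : 0 ≤ q) :
    finsleroidFun g b q = Real.exp (g / √(1 - g ^ 2 / 4) * (finsleroidComplex g b q).arg / 2)
      * ‖finsleroidComplex g b q‖ := by
  have hnorm : √(b ^ 2 + g * q * b + q ^ 2) = ‖finsleroidComplex g b q‖ := by
    rw [Complex.norm_def, normSq_finsleroidComplex hg, finsleroidQuad]
  rw [finsleroidFun, hnorm]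
  by_cases h : b ≠ 0 ∨ q ≠ 0
  · rw [finsleroidAngle_eq_arg hg hq h]
  · have : finsleroidComplex g b q = 0 := by
      obtain ⟨rfl, rfl⟩ := by simpa [not_or] using h
      simp [finsleroidComplex, Complex.ext_iff]
    rw [this, norm_zero, mul_zero, mul_zero]

theorem finsleroidFun_smul (hg : g ∈ Ioo (-2) 2) {t b q : ℝ} (ht : 0 < t) (hq : 0 ≤ q) :
    finsleroidFun g (t * b) (t * q) = t * finsleroidFun g b q := by
  have hz : finsleroidComplex g (t * b) (t * q) = (t : ℂ) * finsleroidComplex g b q := by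
    apply Complex.ext
    · simp only [finsleroidComplex, Complex.re_ofReal_mul]; ring
    · simp only [finsleroidComplex, Complex.im_ofReal_mul]; ring
  rw [finsleroidFun_eq_exp_arg_mul_norm hg hq,
    finsleroidFun_eq_exp_arg_mul_norm hg (mul_nonneg ht.le hq), hz, Complex.arg_real_mul _ ht,
    norm_mul, Complex.norm_of_nonneg ht.le]
  ring

theorem finsleroidFun_pos (hg : g ∈ Ioo (-2) 2) {b q : ℝ} (h : b ≠ 0 ∨ q ≠ 0) :
    0 < finsleroidFun g b q :=
  mul_pos (Real.exp_pos _) (Real.sqrt_pos.2 (finsleroidQuad_pos hg h))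

@[simp]
theorem finsleroidFun_zero_zero (g : ℝ) : finsleroidFun g 0 0 = 0 := by
  simp [finsleroidFun]

theorem finsleroidFun_one_zero (hg : g ∈ Ioo (-2) 2) :
    finsleroidFun g 1 0 = Real.exp (g / √(1 - g ^ 2 / 4) * Real.pi / 4) := by
  have hz : finsleroidComplex g 1 0 = Complex.I := by simp [finsleroidComplex, Complex.ext_iff]
  rw [finsleroidFun_eq_exp_arg_mul_norm hg le_rfl, hz, Complex.arg_I, Complex.norm_I]
  ring_nf

theorem finsleroidFun_neg_one_zero (hg : g ∈ Ioo (-2) 2) :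
    finsleroidFun g (-1) 0 = Real.exp (-(g / √(1 - g ^ 2 / 4) * Real.pi / 4)) := by
  have hz : finsleroidComplex g (-1) 0 = -Complex.I := by
    simp [finsleroidComplex, Complex.ext_iff]
  rw [finsleroidFun_eq_exp_arg_mul_norm hg le_rfl, hz, Complex.arg_neg_I, norm_neg, Complex.norm_I]
  ring_nf

theorem continuousOn_finsleroidFun (hg : g ∈ Ioo (-2) 2) :
    ContinuousOn (fun z : ℝ × ℝ => finsleroidFun g z.1 z.2) {z | 0 ≤ z.2 ∧ z ≠ 0} := by
  have hz : Continuous fun z : ℝ × ℝ => finsleroidComplex g z.1 z.2 :=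
    Complex.equivRealProdCLM.symm.continuous.comp
      (f := fun z : ℝ × ℝ => (√(1 - g ^ 2 / 4) * z.2, z.1 + g / 2 * z.2)) (by fun_prop)
  have harg : ContinuousOn (fun z : ℝ × ℝ => (finsleroidComplex g z.1 z.2).arg)
      {z | 0 ≤ z.2 ∧ z ≠ 0} := fun z hz0 =>
    ((Complex.continuousAt_arg (finsleroidComplex_mem_slitPlane hg hz0.1
      (by simpa [Prod.ext_iff, imp_iff_not_or] using hz0.2))).comp (f := fun z : ℝ × ℝ =>
        finsleroidComplex g z.1 z.2) hz.continuousAt).continuousWithinAt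
  refine ((((continuousOn_const.mul harg).div_const 2).rexp).mul hz.norm.continuousOn).congr
    fun z hz0 => finsleroidFun_eq_exp_arg_mul_norm hg hz0.1

/-- The factor `J² = e^{GΦ}` in `F² = J² (b² + g q b + q²)` for the Finsleroid function `F`. -/
def finsleroidFactor (g b q : ℝ) : ℝ :=
  Real.exp (g / √(1 - g ^ 2 / 4) * (finsleroidComplex g b q).arg)

theorem finsleroidFun_sq (hg : g ∈ Ioo (-2) 2) (b : ℝ) {q : ℝ} (hq : 0 ≤ q) :
    finsleroidFun g b q ^ 2 = finsleroidFactor g b q * finsleroidQuad g b q := by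
  rw [finsleroidFun_eq_exp_arg_mul_norm hg hq, finsleroidFactor, mul_pow,
    ← Complex.normSq_eq_norm_sq, normSq_finsleroidComplex hg, ← Real.exp_nat_mul]
  push_cast
  ring_nf

section Curve

variable {b q : ℝ → ℝ} {b' q' t : ℝ}

theorem hasDerivAt_arg {z : ℝ → ℂ} {z' : ℂ} (hz : HasDerivAt z z' t)
    (hslit : z t ∈ Complex.slitPlane) :
    HasDerivAt (fun t => (z t).arg)
      (((z t).re * z'.im - (z t).im * z'.re) / Complex.normSq (z t)) t := by
  have h := Complex.imCLM.hasFDerivAt.comp_hasDerivAt t (hz.clog_real hslit)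
  refine (h.congr_of_eventuallyEq (.of_forall fun s => (Complex.log_im _).symm)).congr_deriv ?_
  simp only [Complex.imCLM_apply, Complex.div_im]
  ring

theorem hasDerivAt_finsleroidFactor (hg : g ∈ Ioo (-2) 2) (hb : HasDerivAt b b' t)
    (hq : HasDerivAt q q' t) (hpos : 0 < q t) :
    HasDerivAt (fun t => finsleroidFactor g (b t) (q t))
      (finsleroidFactor g (b t) (q t) * (g * (q t * b' - b t * q'))
        / finsleroidQuad g (b t) (q t)) t := by
  have hh := (sqrt_one_sub_sq_div_four_pos hg).ne'
  have hQ := (finsleroidQuad_pos hg (b := b t) (.inr hpos.ne')).ne'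
  have hz : HasDerivAt (fun t => finsleroidComplex g (b t) (q t))
      (finsleroidComplex g b' q') t :=
    Complex.equivRealProdCLM.symm.hasFDerivAt.comp_hasDerivAt t
      ((hq.const_mul √(1 - g ^ 2 / 4)).prodMk (hb.add (hq.const_mul (g / 2))))
  have harg := hasDerivAt_arg hz (finsleroidComplex_mem_slitPlane hg hpos.le (.inr hpos.ne'))
  refine (harg.const_mul (g / √(1 - g ^ 2 / 4))).exp.congr_deriv ?_
  rw [normSq_finsleroidComplex hg, finsleroidFactor]
  simp only [finsleroidComplex]
  generalize √(1 - g ^ 2 / 4) = h at hh ⊢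
  field_simp
  ring

theorem hasDerivAt_half_finsleroidFun_sq (hg : g ∈ Ioo (-2) 2) (hb : HasDerivAt b b' t)
    (hq : HasDerivAt q q' t) (hpos : 0 < q t) :
    HasDerivAt (fun t => 1 / 2 * finsleroidFun g (b t) (q t) ^ 2)
      (finsleroidFactor g (b t) (q t) * ((b t + g * q t) * b' + q t * q')) t := by
  have hQ := finsleroidQuad_pos hg (b := b t) (.inr hpos.ne')
  have hquad : HasDerivAt (fun t => finsleroidQuad g (b t) (q t)) _ t :=
    ((hb.pow 2).add ((hq.const_mul g).mul hb)).add (hq.pow 2)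
  have hsq : (fun t => 1 / 2 * finsleroidFun g (b t) (q t) ^ 2) =ᶠ[𝓝 t]
      fun t => 1 / 2 * (finsleroidFactor g (b t) (q t) * finsleroidQuad g (b t) (q t)) := by
    filter_upwards [hq.continuousAt.eventually (lt_mem_nhds hpos)] with s hs
    rw [finsleroidFun_sq hg _ hs.le]
  refine ((((hasDerivAt_finsleroidFactor hg hb hq hpos).mul hquad).const_mul
    (1 / 2)).congr_of_eventuallyEq hsq).congr_deriv ?_
  rw [div_mul_cancel₀ _ hQ.ne']
  push_cast
  ring

end Curve

end Finsleroid

/-! ### Second derivatives and homogeneous functions -/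

section SecondDeriv

variable {φ ψ : ℝ → ℝ} {a c t : ℝ}

/-- `a` is the second derivative of `φ` at `t`, `φ` being differentiable near `t`. -/
def HasSecondDerivAt (φ : ℝ → ℝ) (a t : ℝ) : Prop :=
  ∃ φ' : ℝ → ℝ, (∀ᶠ s in 𝓝 t, HasDerivAt φ (φ' s) s) ∧ HasDerivAt φ' a t

namespace HasSecondDerivAt

theorem const_mul (r : ℝ) (h : HasSecondDerivAt φ a t) :
    HasSecondDerivAt (fun s => r * φ s) (r * a) t := by
  obtain ⟨φ', hφ, hφ'⟩ := h
  exact ⟨fun s => r * φ' s, hφ.mono fun s hs => hs.const_mul r, hφ'.const_mul r⟩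

theorem nonneg_of_isLocalMin (h : HasSecondDerivAt φ a t) (hmin : IsLocalMin φ t) : 0 ≤ a := by
  obtain ⟨φ', hφ, hφ'⟩ := h
  have hderiv : deriv φ =ᶠ[𝓝 t] φ' := hφ.mono fun s hs => hs.deriv
  have hsecond : deriv (deriv φ) t = a := by rw [hderiv.deriv_eq, hφ'.deriv]
  by_contra! ha
  have hmax : IsLocalMax φ t := isLocalMax_of_deriv_deriv_neg (hsecond.trans_lt ha)
    hmin.deriv_eq_zero hφ.self_of_nhds.continuousAt
  have hconst : φ =ᶠ[𝓝 t] fun _ => φ t := by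
    filter_upwards [hmin, hmax] with s h₁ h₂ using le_antisymm h₂ h₁
  have hzero : deriv (deriv φ) t = 0 := by
    rw [hconst.deriv.deriv_eq]; simp
  linarith

theorem le_of_eventually_le (hφ : HasSecondDerivAt φ a t) (hψ : HasSecondDerivAt ψ c t)
    (hle : φ ≤ᶠ[𝓝 t] ψ) (heq : φ t = ψ t) : a ≤ c := by
  obtain ⟨φ', hφ, hφ'⟩ := hφ
  obtain ⟨ψ', hψ, hψ'⟩ := hψ
  have hsub : HasSecondDerivAt (ψ - φ) (c - a) t :=
    ⟨ψ' - φ', by filter_upwards [hφ, hψ] with s h₁ h₂ using h₂.sub h₁, hψ'.sub hφ'⟩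
  refine sub_nonneg.1 (hsub.nonneg_of_isLocalMin ?_)
  filter_upwards [hle] with s hs
  simpa [heq] using hs

end HasSecondDerivAt

theorem hasSecondDerivAt_half_finsleroidFun_sq {g : ℝ} (hg : g ∈ Ioo (-2) 2) (b β σ Z : ℝ) {q : ℝ}
    (hq : 0 < q) :
    HasSecondDerivAt (fun t => 1 / 2 * finsleroidFun g (b + t * β)
        (√(q ^ 2 + 2 * t * σ + t ^ 2 * Z)) ^ 2)
      (finsleroidFactor g b q / finsleroidQuad g b q *
        ((b ^ 2 + q ^ 2) * (σ / q + g * q ^ 2 * β / (b ^ 2 + q ^ 2)) ^ 2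
          + (Z - (σ / q) ^ 2) * finsleroidQuad g b q
          + finsleroidQuad g b q ^ 2 * β ^ 2 / (b ^ 2 + q ^ 2))) 0 := by
  set Q : ℝ → ℝ := fun t => q ^ 2 + 2 * t * σ + t ^ 2 * Z
  have hQ0 : √(Q 0) = q := by simp [Q, Real.sqrt_sq hq.le]
  have hQ : ∀ t, HasDerivAt Q (2 * (σ + t * Z)) t := fun t =>
    (((((hasDerivAt_id t).const_mul 2).mul_const σ).const_add (q ^ 2)).add
      (((hasDerivAt_id t).pow 2).mul_const Z)).congr_deriv (by simp; ring)
  have hb : ∀ t, HasDerivAt (fun t => b + t * β) β t := fun t => by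
    simpa using ((hasDerivAt_id t).mul_const β).const_add b
  have hpos : ∀ᶠ t in 𝓝 (0 : ℝ), 0 < Q t :=
    (hQ 0).continuousAt.eventually (lt_mem_nhds (Real.sqrt_pos.1 (hQ0.symm ▸ hq)))
  have hsqrt : ∀ t, 0 < Q t → HasDerivAt (fun t => √(Q t)) ((σ + t * Z) / √(Q t)) t :=
    fun t ht => ((hQ t).sqrt ht.ne').congr_deriv (mul_div_mul_left _ _ two_ne_zero)
  refine ⟨fun t => finsleroidFactor g (b + t * β) (√(Q t)) *
    ((b + t * β + g * √(Q t)) * β + (σ + t * Z)), ?_, ?_⟩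
  · filter_upwards [hpos] with t ht
    refine (hasDerivAt_half_finsleroidFun_sq hg (hb t) (hsqrt t ht)
      (Real.sqrt_pos.2 ht)).congr_deriv ?_
    rw [mul_div_cancel₀ _ (Real.sqrt_pos.2 ht).ne']
  · have hfactor := hasDerivAt_finsleroidFactor hg (hb 0) (hsqrt 0 hpos.self_of_nhds)
      (Real.sqrt_pos.2 hpos.self_of_nhds)
    have hlinear : HasDerivAt (fun t => (b + t * β + g * √(Q t)) * β + (σ + t * Z)) _ 0 :=
      (((hb 0).add ((hsqrt 0 hpos.self_of_nhds).const_mul g)).mul_const β).add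
        (((hasDerivAt_id (0 : ℝ)).mul_const Z).const_add σ)
    refine (hfactor.mul hlinear).congr_deriv ?_
    have hB := (finsleroidQuad_pos hg (b := b) (.inr hq.ne')).ne'
    have hbq : b ^ 2 + q ^ 2 ≠ 0 := by positivity
    simp only [hQ0, zero_mul, add_zero, one_mul]
    field_simp
    rw [finsleroidQuad]
    ring

end SecondDeriv

section Homogeneous

variable {V : Type*} [NormedAddCommGroup V] [NormedSpace ℝ V] {φ : V → ℝ} {y : V}

theorem fderiv_smul_of_homogeneous_two (hφ : ∀ y : V, ∀ t : ℝ, 0 < t → φ (t • y) = t ^ 2 * φ y)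
    {t : ℝ} (ht : 0 < t) (y : V) : fderiv ℝ φ (t • y) = t • fderiv ℝ φ y := by
  have hscale : (fun z => φ (t • z)) = (t ^ 2) • φ := funext fun z => by simpa using hφ z t ht
  have h := congrArg (fderiv ℝ · y) hscale
  simp only [fderiv_comp_smul] at h
  rw [fderiv_const_smul_field, Pi.smul_apply, pow_two, mul_smul] at h
  exact smul_right_injective _ ht.ne' h

theorem fderiv_fderiv_smul_of_homogeneous_two
    (hφ : ∀ y : V, ∀ t : ℝ, 0 < t → φ (t • y) = t ^ 2 * φ y) {t : ℝ} (ht : 0 < t) (y : V) :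
    fderiv ℝ (fderiv ℝ φ) (t • y) = fderiv ℝ (fderiv ℝ φ) y := by
  have hscale : (fun z => fderiv ℝ φ (t • z)) = t • fderiv ℝ φ :=
    funext fun z => fderiv_smul_of_homogeneous_two hφ ht z
  have h := congrArg (fderiv ℝ · y) hscale
  simp only [fderiv_comp_smul, congrFun (fderiv_const_smul_field (f := fderiv ℝ φ) t) y,
    Pi.smul_apply] at h
  exact smul_right_injective _ ht.ne' h

theorem hasDerivAt_comp_smul_one {W : Type*} [NormedAddCommGroup W] [NormedSpace ℝ W] {ψ : V → W}
    (hψ : DifferentiableAt ℝ ψ y) :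
    HasDerivAt (fun t : ℝ => ψ (t • y)) (fderiv ℝ ψ y y) 1 := by
  have h : HasFDerivAt ψ (fderiv ℝ ψ y) ((1 : ℝ) • y) := by simpa using hψ.hasFDerivAt
  exact (h.comp_hasDerivAt (1 : ℝ) ((hasDerivAt_id (1 : ℝ)).smul_const y)).congr_deriv (by simp)

theorem fderiv_apply_self_of_homogeneous_two
    (hφ : ∀ y : V, ∀ t : ℝ, 0 < t → φ (t • y) = t ^ 2 * φ y) (hd : DifferentiableAt ℝ φ y) :
    fderiv ℝ φ y y = 2 * φ y := by
  have h : HasDerivAt (fun t : ℝ => t ^ 2 * φ y) (2 * φ y) 1 := by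
    simpa using (hasDerivAt_pow 2 (1 : ℝ)).mul_const (φ y)
  refine (hasDerivAt_comp_smul_one hd).unique (h.congr_of_eventuallyEq ?_)
  filter_upwards [lt_mem_nhds (zero_lt_one' ℝ)] with t ht using hφ y t ht

theorem fderiv_fderiv_apply_self_of_homogeneous_two
    (hφ : ∀ y : V, ∀ t : ℝ, 0 < t → φ (t • y) = t ^ 2 * φ y)
    (hd : DifferentiableAt ℝ (fderiv ℝ φ) y) : fderiv ℝ (fderiv ℝ φ) y y = fderiv ℝ φ y := by
  have h : HasDerivAt (fun t : ℝ => t • fderiv ℝ φ y) (fderiv ℝ φ y) 1 := by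
    simpa using (hasDerivAt_id (1 : ℝ)).smul_const (fderiv ℝ φ y)
  refine (hasDerivAt_comp_smul_one hd).unique (h.congr_of_eventuallyEq ?_)
  filter_upwards [lt_mem_nhds (zero_lt_one' ℝ)] with t ht
    using fderiv_smul_of_homogeneous_two hφ ht y

theorem hasDerivAt_line (y X : V) (t : ℝ) : HasDerivAt (fun t : ℝ => y + t • X) X t := by
  simpa using ((hasDerivAt_id t).smul_const X).const_add y

theorem tendsto_line (y X : V) : Tendsto (fun t : ℝ => y + t • X) (𝓝 0) (𝓝 y) := by
  simpa using (hasDerivAt_line y X 0).continuousAt.tendsto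

theorem differentiableAt_fderiv_of_contDiffAt_two (h : ContDiffAt ℝ 2 φ y) :
    DifferentiableAt ℝ (fderiv ℝ φ) y :=
  (h.fderiv_right (m := 1) (by norm_num)).differentiableAt (by norm_num)

theorem hasSecondDerivAt_comp_line (h : ContDiffAt ℝ 2 φ y) (X : V) :
    HasSecondDerivAt (fun t : ℝ => φ (y + t • X)) (fderiv ℝ (fderiv ℝ φ) y X X) 0 := by
  refine ⟨fun t => fderiv ℝ φ (y + t • X) X, ?_, ?_⟩
  · have hdiff : ∀ᶠ z in 𝓝 y, DifferentiableAt ℝ φ z :=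
      (h.eventually (by simp)).mono fun z hz => hz.differentiableAt (by norm_num)
    filter_upwards [(tendsto_line y X).eventually hdiff] with t ht
    exact ht.hasFDerivAt.comp_hasDerivAt t (hasDerivAt_line y X t)
  · have h₀ : HasFDerivAt (fderiv ℝ φ) (fderiv ℝ (fderiv ℝ φ) y) (y + (0 : ℝ) • X) := by
      simpa using (differentiableAt_fderiv_of_contDiffAt_two h).hasFDerivAt
    exact (ContinuousLinearMap.apply ℝ ℝ X).hasFDerivAt.comp_hasDerivAt (0 : ℝ)
      (h₀.comp_hasDerivAt (0 : ℝ) (hasDerivAt_line y X 0))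

theorem exists_forall_ne_zero_le_mul [FiniteDimensional ℝ V] [Nontrivial V] {f k : V → ℝ}
    (hf : ∀ y, y ≠ 0 → ContinuousAt f y) (hk : ∀ y, y ≠ 0 → ContinuousAt k y)
    (hf_smul : ∀ y, ∀ t : ℝ, 0 < t → f (t • y) = t * f y)
    (hk_smul : ∀ y, ∀ t : ℝ, 0 < t → k (t • y) = t * k y) (hk_pos : ∀ y, y ≠ 0 → 0 < k y) :
    ∃ y₀, y₀ ≠ 0 ∧ ∃ r, f y₀ = r * k y₀ ∧ ∀ y, y ≠ 0 → f y ≤ r * k y := by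
  have : ProperSpace V := FiniteDimensional.proper ℝ V
  have hne : ∀ y ∈ Metric.sphere (0 : V) 1, y ≠ 0 := fun y hy =>
    ne_zero_of_mem_unit_sphere ⟨y, hy⟩
  have hcont : ContinuousOn (fun y => f y / k y) (Metric.sphere (0 : V) 1) := fun y hy =>
    ((hf y (hne y hy)).div (hk y (hne y hy)) (hk_pos y (hne y hy)).ne').continuousWithinAt
  obtain ⟨y₀, hy₀, hmax⟩ :=
    (isCompact_sphere (0 : V) 1).exists_isMaxOn (NormedSpace.sphere_nonempty.2 zero_le_one) hcont
  refine ⟨y₀, hne y₀ hy₀, f y₀ / k y₀, (div_mul_cancel₀ _ (hk_pos y₀ (hne y₀ hy₀)).ne').symm,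
    fun y hy => ?_⟩
  have hn : 0 < ‖y‖⁻¹ := by positivity
  have hle : f (‖y‖⁻¹ • y) / k (‖y‖⁻¹ • y) ≤ f y₀ / k y₀ := hmax (by simp [norm_smul, hy])
  rwa [hf_smul y _ hn, hk_smul y _ hn, mul_div_mul_left _ _ hn.ne', div_le_iff₀ (hk_pos y hy)]
    at hle

end Homogeneous

/-! ### Comparison of gauges -/

section Comparisons

variable {V : Type*} [NormedAddCommGroup V] [NormedSpace ℝ V] {η : V →L[ℝ] ℝ}
  {A : LinearMap.BilinForm ℝ V} {y : V}

section UnitForm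

/-- The bilinear form `A - η ⊗ η`, whose square root is the function `q` of a Finsleroid with
Riemannian metric `A` and axis `η`. -/
def transverseForm (A : LinearMap.BilinForm ℝ V) (η : V →L[ℝ] ℝ) : LinearMap.BilinForm ℝ V :=
  A - LinearMap.BilinForm.linMulLin η.toLinearMap η.toLinearMap

theorem transverseForm_apply (v w : V) : transverseForm A η v w = A v w - η v * η w := rfl

/-- `A` is a Euclidean scalar product for which the covector `η` has length one. -/
structure IsUnitForm (A : LinearMap.BilinForm ℝ V) (η : V →L[ℝ] ℝ) : Prop where
  symm : ∀ v w, A v w = A w v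
  pos : ∀ y, y ≠ 0 → 0 < A y y
  exists_dual : ∃ w, (∀ v, A w v = η v) ∧ η w = 1

namespace IsUnitForm

theorem transverseForm_self (hA : IsUnitForm A η) {w : V} (hw : ∀ v, A w v = η v) (hw1 : η w = 1)
    (y : V) : transverseForm A η y y = A (y - η y • w) (y - η y • w) := by
  simp only [transverseForm_apply, map_sub, map_smul, LinearMap.sub_apply, LinearMap.smul_apply,
    smul_eq_mul, hw, hw1, hA.symm y w]
  ring

theorem transverseForm_self_nonneg (hA : IsUnitForm A η) (y : V) : 0 ≤ transverseForm A η y y := by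
  obtain ⟨w, hw, hw1⟩ := hA.exists_dual
  rw [hA.transverseForm_self hw hw1]
  rcases eq_or_ne (y - η y • w) 0 with h | h
  · simp [h]
  · exact (hA.pos _ h).le

theorem eq_smul_of_transverseForm_self_eq_zero (hA : IsUnitForm A η) {w : V}
    (hw : ∀ v, A w v = η v) (hw1 : η w = 1) (hy : transverseForm A η y y = 0) : y = η y • w := by
  by_contra h
  exact (hA.pos _ (sub_ne_zero.2 h)).ne' (hA.transverseForm_self hw hw1 y ▸ hy)

theorem transverseForm_sq_le (hA : IsUnitForm A η) (v w : V) :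
    transverseForm A η v w ^ 2 ≤ transverseForm A η v v * transverseForm A η w w := by
  have hsymm : transverseForm A η w v = transverseForm A η v w := by
    rw [transverseForm_apply, transverseForm_apply, hA.symm, mul_comm]
  simpa only [hsymm, ← pow_two] using LinearMap.BilinForm.apply_mul_apply_le_of_forall_zero_le
    (transverseForm A η) hA.transverseForm_self_nonneg v w

theorem ne_zero_or_sqrt_transverseForm_ne_zero (hA : IsUnitForm A η) (hy : y ≠ 0) :
    η y ≠ 0 ∨ √(transverseForm A η y y) ≠ 0 := by
  refine or_iff_not_imp_left.2 fun h => (Real.sqrt_pos.2 ?_).ne'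
  simpa [transverseForm_apply, not_not.1 h] using hA.pos y hy

end IsUnitForm

/-- The form obtained from `A` by stretching by `μ` in the directions orthogonal to the axis. -/
def stretchedForm (μ : ℝ) (A : LinearMap.BilinForm ℝ V) (η : V →L[ℝ] ℝ) :
    LinearMap.BilinForm ℝ V :=
  LinearMap.BilinForm.linMulLin η.toLinearMap η.toLinearMap + μ ^ 2 • transverseForm A η

theorem stretchedForm_apply (μ : ℝ) (v w : V) :
    stretchedForm μ A η v w = η v * η w + μ ^ 2 * transverseForm A η v w := rfl

theorem transverseForm_stretchedForm (μ : ℝ) (v w : V) :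
    transverseForm (stretchedForm μ A η) η v w = μ ^ 2 * transverseForm A η v w := by
  rw [transverseForm_apply, stretchedForm_apply]; ring

protected theorem IsUnitForm.stretchedForm (hA : IsUnitForm A η) {μ : ℝ} (hμ : 0 < μ) :
    IsUnitForm (stretchedForm μ A η) η where
  symm v w := by
    simp only [stretchedForm_apply, transverseForm_apply, hA.symm v w, mul_comm (η v)]
  pos y hy := by
    rw [stretchedForm_apply, ← pow_two]
    have hq := mul_nonneg (sq_nonneg μ) (hA.transverseForm_self_nonneg y)
    rcases eq_or_ne (η y) 0 with h | h
    · have : 0 < transverseForm A η y y := by simpa [transverseForm_apply, h] using hA.pos y hy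
      positivity
    · positivity
  exists_dual := by
    obtain ⟨w, hw, hw1⟩ := hA.exists_dual
    refine ⟨w, fun v => ?_, hw1⟩
    rw [stretchedForm_apply, transverseForm_apply, hw, hw1]; ring

end UnitForm

section MaximumPrinciple

/-- A positively homogeneous function that is positive and continuous off the origin. -/
structure IsGauge (F : V → ℝ) : Prop where
  smul : ∀ (y : V) (t : ℝ), 0 < t → F (t • y) = t * F y
  pos : ∀ y, y ≠ 0 → 0 < F y
  continuousAt : ∀ y, y ≠ 0 → ContinuousAt F y

/-- `c = F(y)² |η|²`, where `|η|` is the length of `η` for the Hessian of `½ F²` at `y`; expressed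
by the extremal property `|η|² = max η(X)² / |X|²` and second derivatives along lines, so that it
does not presuppose that `F` is twice differentiable. -/
structure IsDualSqAt (F : V → ℝ) (η : V →L[ℝ] ℝ) (y : V) (c : ℝ) : Prop where
  le : ∀ X, ∃ e, HasSecondDerivAt (fun t => 1 / 2 * F (y + t • X) ^ 2) e 0 ∧
    F y ^ 2 * η X ^ 2 ≤ c * e
  eq : ∃ X e, η X ≠ 0 ∧ HasSecondDerivAt (fun t => 1 / 2 * F (y + t • X) ^ 2) e 0 ∧
    F y ^ 2 * η X ^ 2 = c * e

variable {F K : V → ℝ} {c d : ℝ}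

theorem IsGauge.const_mul (hF : IsGauge F) {r : ℝ} (hr : 0 < r) : IsGauge fun y => r * F y where
  smul y t ht := by rw [hF.smul y t ht, mul_left_comm]
  pos y hy := mul_pos hr (hF.pos y hy)
  continuousAt y hy := continuousAt_const.mul (hF.continuousAt y hy)

theorem IsDualSqAt.const_mul (hF : IsDualSqAt F η y c) (r : ℝ) :
    IsDualSqAt (fun z => r * F z) η y c := by
  have hscale : ∀ {X e}, HasSecondDerivAt (fun t => 1 / 2 * F (y + t • X) ^ 2) e 0 →
      HasSecondDerivAt (fun t => 1 / 2 * (r * F (y + t • X)) ^ 2) (r ^ 2 * e) 0 := fun {X e} h => by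
    convert h.const_mul (r ^ 2) using 2
    ring
  refine ⟨fun X => ?_, ?_⟩
  · obtain ⟨e, he, hle⟩ := hF.le X
    refine ⟨_, hscale he, ?_⟩
    linarith [mul_le_mul_of_nonneg_left hle (sq_nonneg r)]
  · obtain ⟨X, e, hX, he, heq⟩ := hF.eq
    refine ⟨X, _, hX, hscale he, ?_⟩
    linear_combination r ^ 2 * heq

theorem IsDualSqAt.le_of_eventually_le (hF : IsDualSqAt F η y c) (hK : IsDualSqAt K η y d)
    (hc : 0 ≤ c) (hpos : ∀ᶠ z in 𝓝 y, 0 < F z) (hle : F ≤ᶠ[𝓝 y] K) (heq : F y = K y) :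
    d ≤ c := by
  obtain ⟨X, eK, hX, heK, hKX⟩ := hK.eq
  obtain ⟨eF, heF, hFX⟩ := hF.le X
  have hsecond : eF ≤ eK := by
    refine heF.le_of_eventually_le heK ?_ (by simp [heq])
    filter_upwards [(tendsto_line y X).eventually (hpos.and hle)] with t ht
    have := pow_le_pow_left₀ ht.1.le ht.2 2
    linarith
  have hKy : 0 < K y ^ 2 * η X ^ 2 := by
    rw [← heq]
    have := hpos.self_of_nhds
    positivity
  have hchain : d * eK ≤ c * eK := by
    calc d * eK = F y ^ 2 * η X ^ 2 := by rw [heq, hKX]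
      _ ≤ c * eF := hFX
      _ ≤ c * eK := by gcongr
  by_contra! hlt
  have heKpos : 0 < eK := pos_of_mul_pos_right (hKX ▸ hKy) (hc.trans hlt.le)
  exact hlt.not_ge (le_of_mul_le_mul_right hchain heKpos)

-- At a maximum `y₀` of `F / K` with value `r`, the inequality `F ≤ r K` is a contact of second
-- order, so the dual square of `K` at `y₀` is at most that of `F`.
theorem IsGauge.le_of_dualSq_lt [FiniteDimensional ℝ V] (hF : IsGauge F) (hK : IsGauge K)
    (h : ∀ y, y ≠ 0 → F y ≤ K y ∨
      ∃ c d, 0 ≤ c ∧ c < d ∧ IsDualSqAt F η y c ∧ IsDualSqAt K η y d)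
    (hy : y ≠ 0) : F y ≤ K y := by
  have : Nontrivial V := ⟨y, 0, hy⟩
  obtain ⟨y₀, hy₀, r, hr, hle⟩ := exists_forall_ne_zero_le_mul hF.continuousAt hK.continuousAt
    hF.smul hK.smul hK.pos
  have hne : ∀ᶠ z in 𝓝 y₀, z ≠ 0 := isOpen_ne.mem_nhds hy₀
  rcases h y₀ hy₀ with h₀ | ⟨c, d, hc, hcd, hFc, hKd⟩
  · have hr1 : r ≤ 1 := le_of_mul_le_mul_right (by rw [← hr, one_mul]; exact h₀) (hK.pos y₀ hy₀)
    calc F y ≤ r * K y := hle y hy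
      _ ≤ 1 * K y := mul_le_mul_of_nonneg_right hr1 (hK.pos y hy).le
      _ = K y := one_mul _
  · exact absurd (hFc.le_of_eventually_le (hKd.const_mul r) hc (hne.mono fun z hz => hF.pos z hz)
      (hne.mono fun z hz => hle z hz) hr) hcd.not_ge

end MaximumPrinciple

section FinsleroidNorm

variable {g : ℝ}

/-- The Finsleroid norm of the scalar product `A` and the axis `η`. -/
def finsleroidNorm (g : ℝ) (A : LinearMap.BilinForm ℝ V) (η : V →L[ℝ] ℝ) (y : V) : ℝ :=
  finsleroidFun g (η y) (√(transverseForm A η y y))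

theorem finsleroidNorm_smul (hg : g ∈ Ioo (-2) 2) (y : V) {t : ℝ} (ht : 0 < t) :
    finsleroidNorm g A η (t • y) = t * finsleroidNorm g A η y := by
  have hq : √(transverseForm A η (t • y) (t • y)) = t * √(transverseForm A η y y) := by
    simp only [map_smul, LinearMap.smul_apply, smul_eq_mul]
    rw [← mul_assoc, Real.sqrt_mul (mul_self_nonneg t), Real.sqrt_mul_self ht.le]
  rw [finsleroidNorm, hq, map_smul, smul_eq_mul, finsleroidFun_smul hg ht (Real.sqrt_nonneg _),
    finsleroidNorm]

theorem finsleroidNorm_stretchedForm {μ : ℝ} (hμ : 0 < μ) (y : V) :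
    finsleroidNorm g (stretchedForm μ A η) η y
      = finsleroidFun g (η y) (μ * √(transverseForm A η y y)) := by
  rw [finsleroidNorm, transverseForm_stretchedForm, Real.sqrt_mul (sq_nonneg μ),
    Real.sqrt_sq hμ.le]

namespace IsUnitForm

theorem mem_finsleroidFun_domain (hA : IsUnitForm A η) (hy : y ≠ 0) :
    (η y, √(transverseForm A η y y)) ∈ {z : ℝ × ℝ | 0 ≤ z.2 ∧ z ≠ 0} :=
  ⟨Real.sqrt_nonneg _, fun h => (hA.ne_zero_or_sqrt_transverseForm_ne_zero hy).elim
    (· (congrArg Prod.fst h)) (· (congrArg Prod.snd h))⟩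

theorem continuousAt_finsleroidNorm [FiniteDimensional ℝ V] (hA : IsUnitForm A η)
    (hg : g ∈ Ioo (-2) 2) (hy : y ≠ 0) : ContinuousAt (finsleroidNorm g A η) y := by
  have hT : Continuous fun y => transverseForm A η y y :=
    (transverseForm A η).toContinuousBilinearMap.continuous.clm_apply continuous_id
  have hpair : Tendsto (fun y => (η y, √(transverseForm A η y y))) (𝓝 y)
      (𝓝[{z : ℝ × ℝ | 0 ≤ z.2 ∧ z ≠ 0}] (η y, √(transverseForm A η y y))) :=
    tendsto_nhdsWithin_iff.2 ⟨(η.continuous.prodMk hT.sqrt).continuousAt,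
      Filter.Eventually.mono (isOpen_ne.mem_nhds hy) fun _ hz => hA.mem_finsleroidFun_domain hz⟩
  have := (continuousOn_finsleroidFun hg _ (hA.mem_finsleroidFun_domain hy)).tendsto.comp hpair
  unfold finsleroidNorm ContinuousAt
  simpa only [Function.comp_def] using this

theorem tendsto_finsleroidNorm_stretchedForm (hA : IsUnitForm A η) (hg : g ∈ Ioo (-2) 2)
    (hy : y ≠ 0) :
    Tendsto (fun μ => finsleroidNorm g (stretchedForm μ A η) η y) (𝓝 1)
      (𝓝 (finsleroidNorm g A η y)) := by
  set q := √(transverseForm A η y y)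
  have hpos : ∀ᶠ μ : ℝ in 𝓝 1, 0 < μ := lt_mem_nhds one_pos
  have hpair : Tendsto (fun μ => (η y, μ * q)) (𝓝 1)
      (𝓝[{z : ℝ × ℝ | 0 ≤ z.2 ∧ z ≠ 0}] (η y, q)) := by
    refine tendsto_nhdsWithin_iff.2 ⟨?_, hpos.mono fun μ hμ => ?_⟩
    · exact Continuous.tendsto' (by fun_prop) _ _ (by rw [one_mul])
    · have := (hA.stretchedForm hμ).mem_finsleroidFun_domain hy
      rwa [transverseForm_stretchedForm, Real.sqrt_mul (sq_nonneg μ), Real.sqrt_sq hμ.le] at this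
  refine ((continuousOn_finsleroidFun hg _ (hA.mem_finsleroidFun_domain hy)).tendsto.comp
    hpair).congr' (hpos.mono fun μ hμ => ?_)
  exact (finsleroidNorm_stretchedForm hμ y).symm

theorem isGauge_finsleroidNorm [FiniteDimensional ℝ V] (hA : IsUnitForm A η)
    (hg : g ∈ Ioo (-2) 2) : IsGauge (finsleroidNorm g A η) where
  smul y _ ht := finsleroidNorm_smul hg y ht
  pos _ hy := finsleroidFun_pos hg (hA.ne_zero_or_sqrt_transverseForm_ne_zero hy)
  continuousAt _ hy := hA.continuousAt_finsleroidNorm hg hy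

theorem hasSecondDerivAt_half_finsleroidNorm_sq (hA : IsUnitForm A η) (hg : g ∈ Ioo (-2) 2)
    {q : ℝ} (hq : 0 < q) (hqy : q ^ 2 = transverseForm A η y y) (X : V) :
    HasSecondDerivAt (fun t => 1 / 2 * finsleroidNorm g A η (y + t • X) ^ 2)
      (finsleroidFactor g (η y) q / finsleroidQuad g (η y) q *
        (A y y * (transverseForm A η y X / q + g * q ^ 2 * η X / A y y) ^ 2
          + (transverseForm A η X X - (transverseForm A η y X / q) ^ 2)
            * finsleroidQuad g (η y) q
          + finsleroidQuad g (η y) q ^ 2 * η X ^ 2 / A y y)) 0 := by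
  have hAy : A y y = η y ^ 2 + q ^ 2 := by rw [hqy, transverseForm_apply]; ring
  rw [hAy]
  convert hasSecondDerivAt_half_finsleroidFun_sq hg (η y) (η X) (transverseForm A η y X)
    (transverseForm A η X X) hq using 2 with t
  have hline : transverseForm A η (y + t • X) (y + t • X)
      = q ^ 2 + 2 * t * transverseForm A η y X + t ^ 2 * transverseForm A η X X := by
    rw [hqy]
    simp only [transverseForm_apply, map_add, map_smul, LinearMap.add_apply, LinearMap.smul_apply,
      smul_eq_mul, hA.symm X y]
    ring
  rw [finsleroidNorm, hline, map_add, map_smul, smul_eq_mul]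

theorem isDualSqAt_finsleroidNorm (hA : IsUnitForm A η) (hg : g ∈ Ioo (-2) 2)
    (hy : 0 < transverseForm A η y y) : IsDualSqAt (finsleroidNorm g A η) η y (A y y) := by
  set q := √(transverseForm A η y y)
  have hq : 0 < q := Real.sqrt_pos.2 hy
  have hqy : q ^ 2 = transverseForm A η y y := Real.sq_sqrt hy.le
  have hy0 : y ≠ 0 := by rintro rfl; simp at hy
  have hD := hA.pos y hy0
  have hK : finsleroidNorm g A η y ^ 2
      = finsleroidFactor g (η y) q * finsleroidQuad g (η y) q :=
    finsleroidFun_sq hg _ hq.le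
  have hsecond := hA.hasSecondDerivAt_half_finsleroidNorm_sq hg hq hqy
  have hB := finsleroidQuad_pos hg (b := η y) (.inr hq.ne')
  have hJ : 0 < finsleroidFactor g (η y) q := Real.exp_pos _
  generalize finsleroidQuad g (η y) q = B at hK hsecond hB
  generalize finsleroidFactor g (η y) q = J at hK hsecond hJ
  refine ⟨fun X => ⟨_, hsecond X, ?_⟩, ?_⟩
  · have hCS : 0 ≤ transverseForm A η X X - (transverseForm A η y X / q) ^ 2 := by
      rw [sub_nonneg, div_pow, div_le_iff₀ (pow_pos hq 2), hqy, mul_comm]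
      exact hA.transverseForm_sq_le y X
    calc finsleroidNorm g A η y ^ 2 * η X ^ 2
        = A y y * (J / B * (B ^ 2 * η X ^ 2 / A y y)) := by rw [hK]; field_simp
      _ ≤ _ := by
        gcongr
        exact le_add_of_nonneg_left (by positivity)
  · obtain ⟨w, hw, hw1⟩ := hA.exists_dual
    set X := w - (g * q / A y y) • (y - η y • w) with hX
    have hηX : η X = 1 := by simp [hX, hw1]
    have hyX : transverseForm A η y X = -(g * q / A y y) * q ^ 2 := by
      rw [hqy]
      simp only [hX, transverseForm_apply, map_sub, map_smul, smul_eq_mul, hA.symm y w, hw, hw1]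
      ring
    have hXX : transverseForm A η X X = (g * q / A y y) ^ 2 * q ^ 2 := by
      rw [hqy]
      simp only [hX, transverseForm_apply, map_sub, map_smul, LinearMap.sub_apply,
        LinearMap.smul_apply, smul_eq_mul, hA.symm y w, hw, hw1]
      ring
    refine ⟨X, _, by simp [hηX], hsecond X, ?_⟩
    rw [hK, hηX, hyX, hXX]
    field_simp
    ring

end IsUnitForm

end FinsleroidNorm

end Comparisons

/-! ### Minkowski norms with a quadratic dual norm -/

section MinkowskiNorm

variable {V : Type*} [NormedAddCommGroup V] [NormedSpace ℝ V] {F : V → ℝ} {y : V}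

/-- The fundamental tensor of `F`, the Hessian of `½ F²`. -/
def fundamentalTensor (F : V → ℝ) (y : V) : V →L[ℝ] V →L[ℝ] ℝ :=
  fderiv ℝ (fderiv ℝ fun z => 1 / 2 * F z ^ 2) y

/-- A not necessarily reversible Minkowski norm of class `C²`. -/
structure IsMinkowskiNorm (F : V → ℝ) : Prop where
  nonneg : ∀ y, 0 ≤ F y
  smul : ∀ (y : V) (t : ℝ), 0 < t → F (t • y) = t * F y
  contDiffAt : ∀ y, y ≠ 0 → ContDiffAt ℝ 2 F y
  posDef : ∀ y, y ≠ 0 → ∀ X, X ≠ 0 → 0 < fundamentalTensor F y X X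

namespace IsMinkowskiNorm

theorem contDiffAt_half_sq (hF : IsMinkowskiNorm F) (hy : y ≠ 0) :
    ContDiffAt ℝ 2 (fun z => 1 / 2 * F z ^ 2) y :=
  contDiffAt_const.mul ((hF.contDiffAt y hy).pow 2)

theorem half_sq_smul (hF : IsMinkowskiNorm F) (y : V) (t : ℝ) (ht : 0 < t) :
    1 / 2 * F (t • y) ^ 2 = t ^ 2 * (1 / 2 * F y ^ 2) := by
  rw [hF.smul y t ht]; ring

theorem fundamentalTensor_symm (hF : IsMinkowskiNorm F) (hy : y ≠ 0) (X Y : V) :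
    fundamentalTensor F y X Y = fundamentalTensor F y Y X :=
  ((hF.contDiffAt_half_sq hy).isSymmSndFDerivAt (by simp)).eq X Y

theorem fundamentalTensor_smul (hF : IsMinkowskiNorm F) {t : ℝ} (ht : 0 < t) (y : V) :
    fundamentalTensor F (t • y) = fundamentalTensor F y :=
  fderiv_fderiv_smul_of_homogeneous_two hF.half_sq_smul ht y

theorem fundamentalTensor_apply_self (hF : IsMinkowskiNorm F) (hy : y ≠ 0) :
    fundamentalTensor F y y = fderiv ℝ (fun z => 1 / 2 * F z ^ 2) y :=
  fderiv_fderiv_apply_self_of_homogeneous_two hF.half_sq_smul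
    (differentiableAt_fderiv_of_contDiffAt_two (hF.contDiffAt_half_sq hy))

theorem fundamentalTensor_self_self (hF : IsMinkowskiNorm F) (hy : y ≠ 0) :
    fundamentalTensor F y y y = F y ^ 2 := by
  rw [hF.fundamentalTensor_apply_self hy, fderiv_apply_self_of_homogeneous_two hF.half_sq_smul
    ((hF.contDiffAt_half_sq hy).differentiableAt (by norm_num))]
  ring

theorem pos (hF : IsMinkowskiNorm F) (hy : y ≠ 0) : 0 < F y := by
  have h := hF.posDef y hy y hy
  rw [hF.fundamentalTensor_self_self hy] at h
  exact (hF.nonneg y).lt_of_ne' (pow_ne_zero_iff two_ne_zero |>.1 h.ne')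

theorem apply_zero (hF : IsMinkowskiNorm F) : F 0 = 0 := by
  have := hF.smul 0 2 (by norm_num)
  rw [smul_zero] at this
  linarith

theorem isGauge (hF : IsMinkowskiNorm F) : IsGauge F where
  smul := hF.smul
  pos _ hy := hF.pos hy
  continuousAt y hy := (hF.contDiffAt y hy).continuousAt

theorem sq_fundamentalTensor_le (hF : IsMinkowskiNorm F) (hy : y ≠ 0) (X Y : V) :
    fundamentalTensor F y X Y ^ 2 ≤ fundamentalTensor F y X X * fundamentalTensor F y Y Y := by
  have hnonneg : ∀ Z, 0 ≤ (fundamentalTensor F y).toBilinForm Z Z := fun Z => by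
    rcases eq_or_ne Z 0 with rfl | hZ
    · simp
    · exact (hF.posDef y hy Z hZ).le
  have h := LinearMap.BilinForm.apply_mul_apply_le_of_forall_zero_le _ hnonneg X Y
  simpa only [ContinuousLinearMap.toBilinForm_apply, hF.fundamentalTensor_symm hy Y X,
    ← pow_two] using h

end IsMinkowskiNorm

end MinkowskiNorm

section QuadraticDualNorm

variable {V : Type*} [NormedAddCommGroup V] [NormedSpace ℝ V] {F : V → ℝ} {η : V →L[ℝ] ℝ}
  {A : LinearMap.BilinForm ℝ V} {y : V}

/-- `F` is a Minkowski norm for which the function `F² |η|²` is the quadratic form of `A`, where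
`|η|` is the length of the nonzero covector `η` for the fundamental tensor of `F`. -/
structure HasQuadraticDualNorm (F : V → ℝ) (η : V →L[ℝ] ℝ) (A : LinearMap.BilinForm ℝ V) :
    Prop where
  isMinkowskiNorm : IsMinkowskiNorm F
  ne_zero : η ≠ 0
  symm : ∀ v w, A v w = A w v
  quadratic : ∀ y, y ≠ 0 → ∃ W, (∀ X, fundamentalTensor F y W X = η X) ∧ F y ^ 2 * η W = A y y

theorem exists_finsleroid_parameters {r s : ℝ} (hr : 0 < r) (hs : 0 < s) :
    ∃ g ∈ Ioo (-2) 2, ∃ ρ, Real.exp ρ * finsleroidFun g 1 0 = r ∧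
      Real.exp ρ * finsleroidFun g (-1) 0 = s := by
  set G := 2 / Real.pi * (Real.log r - Real.log s) with hG
  have hG1 : 0 < 1 + G ^ 2 / 4 := by positivity
  set g := G / √(1 + G ^ 2 / 4) with hgdef
  have hg_sq : 1 - g ^ 2 / 4 = (1 + G ^ 2 / 4)⁻¹ := by
    rw [hgdef, div_pow, Real.sq_sqrt hG1.le]; field_simp; ring
  have hg : g ∈ Ioo (-2) 2 := by
    have : 0 < 1 - g ^ 2 / 4 := by rw [hg_sq]; positivity
    exact abs_lt.1 (abs_lt_of_sq_lt_sq (by linarith) (by norm_num))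
  have hgG : g / √(1 - g ^ 2 / 4) = G := by
    rw [hg_sq, Real.sqrt_inv, hgdef]; field_simp
  have hGpi : G * Real.pi / 4 = (Real.log r - Real.log s) / 2 := by
    rw [hG]; field_simp; ring
  refine ⟨g, hg, (Real.log r + Real.log s) / 2, ?_, ?_⟩
  · rw [finsleroidFun_one_zero hg, hgG, hGpi, ← Real.exp_add]
    convert Real.exp_log hr using 2; ring
  · rw [finsleroidFun_neg_one_zero hg, hgG, hGpi, ← Real.exp_add]
    convert Real.exp_log hs using 2; ring

namespace HasQuadraticDualNorm

theorem apply_dual_pos (hF : HasQuadraticDualNorm F η A) (hy : y ≠ 0) {W : V}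
    (hW : ∀ X, fundamentalTensor F y W X = η X) : 0 < η W := by
  have hW0 : W ≠ 0 := by
    rintro rfl
    exact hF.ne_zero (ContinuousLinearMap.ext fun X => by simp [← hW X])
  exact hW W ▸ hF.isMinkowskiNorm.posDef y hy W hW0

theorem form_pos (hF : HasQuadraticDualNorm F η A) (hy : y ≠ 0) : 0 < A y y := by
  obtain ⟨W, hW, hA⟩ := hF.quadratic y hy
  exact hA ▸ mul_pos (pow_pos (hF.isMinkowskiNorm.pos hy) 2) (hF.apply_dual_pos hy hW)

theorem sq_mul_sq_le (hF : HasQuadraticDualNorm F η A) (hy : y ≠ 0) (X : V) :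
    F y ^ 2 * η X ^ 2 ≤ A y y * fundamentalTensor F y X X := by
  obtain ⟨W, hW, hA⟩ := hF.quadratic y hy
  calc F y ^ 2 * η X ^ 2 ≤ F y ^ 2 * (η W * fundamentalTensor F y X X) := by
        gcongr
        simpa only [hW] using hF.isMinkowskiNorm.sq_fundamentalTensor_le hy W X
    _ = A y y * fundamentalTensor F y X X := by rw [← hA, mul_assoc]

theorem isDualSqAt (hF : HasQuadraticDualNorm F η A) (hy : y ≠ 0) : IsDualSqAt F η y (A y y) := by
  have hsecond := hasSecondDerivAt_comp_line (hF.isMinkowskiNorm.contDiffAt_half_sq hy)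
  refine ⟨fun X => ⟨_, hsecond X, hF.sq_mul_sq_le hy X⟩, ?_⟩
  obtain ⟨W, hW, hA⟩ := hF.quadratic y hy
  refine ⟨W, _, (hF.apply_dual_pos hy hW).ne', hsecond W, ?_⟩
  rw [← fundamentalTensor, hW, ← hA]
  ring

theorem transverseForm_self_nonneg (hF : HasQuadraticDualNorm F η A) (y : V) :
    0 ≤ transverseForm A η y y := by
  rcases eq_or_ne y 0 with rfl | hy
  · simp
  have h := hF.sq_mul_sq_le hy y
  rw [hF.isMinkowskiNorm.fundamentalTensor_self_self hy, mul_comm (A y y)] at h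
  have := le_of_mul_le_mul_left h (pow_pos (hF.isMinkowskiNorm.pos hy) 2)
  rw [transverseForm_apply]
  linarith

-- Where `η / F` is maximal, `η` is proportional to `dF`, hence its dual vector to `y`.
theorem exists_transverseForm_self_eq_zero [FiniteDimensional ℝ V]
    (hF : HasQuadraticDualNorm F η A) : ∃ y, η y ≠ 0 ∧ transverseForm A η y y = 0 := by
  have hM := hF.isMinkowskiNorm
  obtain ⟨v, hv⟩ : ∃ v, 0 < η v := by
    obtain ⟨v, hv⟩ : ∃ v, η v ≠ 0 := DFunLike.ne_iff.1 hF.ne_zero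
    rcases hv.lt_or_gt with h | h
    · exact ⟨-v, by simpa using h⟩
    · exact ⟨v, h⟩
  have hv0 : v ≠ 0 := by rintro rfl; simp at hv
  have : Nontrivial V := ⟨v, 0, hv0⟩
  obtain ⟨y, hy, r, hr, hle⟩ := exists_forall_ne_zero_le_mul (f := η) (k := F)
    (fun y _ => η.continuous.continuousAt) hM.isGauge.continuousAt (fun y t _ => map_smul η t y)
    hM.smul fun y hy => hM.pos hy
  have hFy := hM.pos hy
  have hrpos : 0 < r := pos_of_mul_pos_left (hv.trans_le (hle v hv0)) (hM.nonneg v)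
  have hdF : HasFDerivAt F (fderiv ℝ F y) y :=
    ((hM.contDiffAt y hy).differentiableAt (by norm_num)).hasFDerivAt
  have hη : r • fderiv ℝ F y = η := by
    have hmin : IsLocalMin (fun z => r * F z - η z) y := by
      filter_upwards [isOpen_ne.mem_nhds hy] with z hz
      have := hle z hz
      linarith
    exact sub_eq_zero.1 (hmin.hasFDerivAt_eq_zero ((hdF.const_mul r).sub η.hasFDerivAt))
  have hB : ∀ X, r * fundamentalTensor F y y X = F y * η X := fun X => by
    rw [hM.fundamentalTensor_apply_self hy, ((hdF.pow 2).const_mul (1 / 2 : ℝ)).fderiv, ← hη]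
    simp
    ring
  obtain ⟨W, hW, hA⟩ := hF.quadratic y hy
  have hηW : η W = r ^ 2 := by
    have h := hB W
    rw [hM.fundamentalTensor_symm hy, hW, hr] at h
    exact mul_left_cancel₀ hFy.ne' (by linear_combination -h)
  refine ⟨y, by rw [hr]; positivity, ?_⟩
  rw [transverseForm_apply, ← hA, hηW, hr]
  ring

theorem isUnitForm [FiniteDimensional ℝ V] (hF : HasQuadraticDualNorm F η A) :
    IsUnitForm A η where
  symm := hF.symm
  pos _ hy := hF.form_pos hy
  exists_dual := by
    obtain ⟨y, hηy, hy⟩ := hF.exists_transverseForm_self_eq_zero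
    have hker : ∀ v, transverseForm A η y v = 0 := fun v => by
      have hCS := LinearMap.BilinForm.apply_mul_apply_le_of_forall_zero_le _
        hF.transverseForm_self_nonneg y v
      rw [hy, zero_mul, transverseForm_apply v, hF.symm v, mul_comm (η v), ← transverseForm_apply,
        ← pow_two] at hCS
      exact pow_eq_zero_iff two_ne_zero |>.1 (hCS.antisymm (sq_nonneg _))
    refine ⟨(η y)⁻¹ • y, fun v => ?_, by simp [hηy]⟩
    have := hker v
    rw [transverseForm_apply, sub_eq_zero] at this
    simp [this, hηy]

section Comparison

variable {g ρ : ℝ} {w : V}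

theorem eq_finsleroidFun_of_transverseForm_self_eq_zero [FiniteDimensional ℝ V]
    (hF : HasQuadraticDualNorm F η A) (hg : g ∈ Ioo (-2) 2) (hw : ∀ v, A w v = η v)
    (hw1 : η w = 1) (hpos : Real.exp ρ * finsleroidFun g 1 0 = F w)
    (hneg : Real.exp ρ * finsleroidFun g (-1) 0 = F (-w)) (hy : y ≠ 0)
    (hT : transverseForm A η y y = 0) : F y = Real.exp ρ * finsleroidFun g (η y) 0 := by
  have hyw := hF.isUnitForm.eq_smul_of_transverseForm_self_eq_zero hw hw1 hT
  have hc : η y ≠ 0 := fun h => hy (by rw [hyw, h, zero_smul])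
  generalize η y = c at hyw hc
  subst hyw
  rcases hc.lt_or_gt with hlt | hgt
  · have hscale := finsleroidFun_smul hg (b := -1) (neg_pos.2 hlt) le_rfl
    rw [mul_zero, neg_mul_neg, mul_one] at hscale
    rw [hscale, mul_left_comm, hneg, ← hF.isMinkowskiNorm.smul _ _ (neg_pos.2 hlt), neg_smul_neg]
  · have hscale := finsleroidFun_smul hg (b := 1) hgt le_rfl
    rw [mul_zero, mul_one] at hscale
    rw [hscale, mul_left_comm, hpos, ← hF.isMinkowskiNorm.smul _ _ hgt]

theorem eq_or_isDualSqAt_stretchedForm [FiniteDimensional ℝ V] (hF : HasQuadraticDualNorm F η A)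
    (hg : g ∈ Ioo (-2) 2)
    (haxis : ∀ y, y ≠ 0 → transverseForm A η y y = 0 → F y = Real.exp ρ * finsleroidFun g (η y) 0)
    {μ : ℝ} (hμ : 0 < μ) (hy : y ≠ 0) :
    F y = Real.exp ρ * finsleroidNorm g (stretchedForm μ A η) η y ∨
      0 < transverseForm A η y y ∧ IsDualSqAt
        (fun z => Real.exp ρ * finsleroidNorm g (stretchedForm μ A η) η z) η y
        (η y ^ 2 + μ ^ 2 * transverseForm A η y y) := by
  rcases (hF.transverseForm_self_nonneg y).eq_or_lt' with hT | hT
  · left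
    rw [haxis y hy hT, finsleroidNorm_stretchedForm hμ, hT, Real.sqrt_zero, mul_zero]
  · refine .inr ⟨hT, ?_⟩
    have h := (hF.isUnitForm.stretchedForm hμ).isDualSqAt_finsleroidNorm hg (y := y)
      (by rw [transverseForm_stretchedForm]; positivity)
    rw [stretchedForm_apply, ← pow_two] at h
    exact h.const_mul _

-- Stretching by `μ > 1` enlarges the dual square off the axis, and shrinking diminishes it.
theorem eq_finsleroidNorm [FiniteDimensional ℝ V] (hF : HasQuadraticDualNorm F η A)
    (hg : g ∈ Ioo (-2) 2)
    (haxis : ∀ y, y ≠ 0 → transverseForm A η y y = 0 → F y = Real.exp ρ * finsleroidFun g (η y) 0)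
    (hy : y ≠ 0) : F y = Real.exp ρ * finsleroidNorm g A η y := by
  have hgauge : ∀ {μ}, 0 < μ →
      IsGauge fun z => Real.exp ρ * finsleroidNorm g (stretchedForm μ A η) η z := fun hμ =>
    ((hF.isUnitForm.stretchedForm hμ).isGauge_finsleroidNorm hg).const_mul (Real.exp_pos ρ)
  have hA : ∀ z, A z z = η z ^ 2 + transverseForm A η z z := fun z => by
    rw [transverseForm_apply]; ring
  have hlim := (hF.isUnitForm.tendsto_finsleroidNorm_stretchedForm hg hy).const_mul (Real.exp ρ)
  refine le_antisymm ?_ ?_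
  · refine ge_of_tendsto (hlim.mono_left (nhdsWithin_le_nhds (s := Ioi 1)))
      (eventually_mem_nhdsWithin.mono fun μ (hμ : 1 < μ) =>
        hF.isMinkowskiNorm.isGauge.le_of_dualSq_lt (η := η)
        (hgauge (by positivity)) (fun z hz => ?_) hy)
    rcases hF.eq_or_isDualSqAt_stretchedForm hg haxis (μ := μ) (by positivity) hz with h | ⟨hT, h⟩
    · exact .inl h.le
    · refine .inr ⟨_, _, (hF.form_pos hz).le, ?_, hF.isDualSqAt hz, h⟩
      rw [hA]
      gcongr
      exact lt_mul_of_one_lt_left hT (one_lt_pow₀ hμ two_ne_zero)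
  · refine le_of_tendsto (hlim.mono_left (nhdsWithin_le_nhds (s := Iio 1)))
      (eventually_of_mem (Ioo_mem_nhdsLT one_pos) fun μ hμ => (hgauge hμ.1).le_of_dualSq_lt (η := η)
        hF.isMinkowskiNorm.isGauge (fun z hz => ?_) hy)
    rcases hF.eq_or_isDualSqAt_stretchedForm hg haxis hμ.1 hz with h | ⟨hT, h⟩
    · exact .inl h.ge
    · refine .inr ⟨_, _, by positivity, ?_, h, hF.isDualSqAt hz⟩
      rw [hA]
      gcongr
      exact mul_lt_of_lt_one_left hT (pow_lt_one₀ hμ.1.le hμ.2 two_ne_zero)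

theorem exists_eq_finsleroidNorm [FiniteDimensional ℝ V] (hF : HasQuadraticDualNorm F η A) :
    ∃ g ∈ Ioo (-2) 2, ∃ ρ, ∀ y, F y = Real.exp ρ * finsleroidNorm g A η y := by
  have hM := hF.isMinkowskiNorm
  obtain ⟨w, hw, hw1⟩ := hF.isUnitForm.exists_dual
  have hw0 : w ≠ 0 := by rintro rfl; simp at hw1
  obtain ⟨g, hg, ρ, hpos, hneg⟩ :=
    exists_finsleroid_parameters (hM.pos hw0) (hM.pos (neg_ne_zero.2 hw0))
  refine ⟨g, hg, ρ, fun y => ?_⟩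
  rcases eq_or_ne y 0 with rfl | hy
  · simp [hM.apply_zero, finsleroidNorm, finsleroidFun_zero_zero]
  · exact hF.eq_finsleroidNorm hg (fun y =>
      hF.eq_finsleroidFun_of_transverseForm_self_eq_zero hg hw hw1 hpos hneg) hy

end Comparison

end HasQuadraticDualNorm

end QuadraticDualNorm

/-! ### Partial derivatives -/

section MatrixRegularity

variable {W : Type*} [NormedAddCommGroup W] [NormedSpace ℝ W] {n : ℕ} {m : WithTop ℕ∞}
  {M : W → Matrix (Fin n) (Fin n) ℝ} {z : W}

theorem contDiffAt_matrix_det (h : ∀ i j, ContDiffAt ℝ m (fun z => M z i j) z) :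
    ContDiffAt ℝ m (fun z => (M z).det) z := by
  simp only [Matrix.det_apply']
  exact ContDiffAt.sum fun σ _ => contDiffAt_const.mul (contDiffAt_prod fun i _ => h _ _)

theorem contDiffAt_matrix_inv (h : ∀ i j, ContDiffAt ℝ m (fun z => M z i j) z)
    (hdet : (M z).det ≠ 0) (i j : Fin n) : ContDiffAt ℝ m (fun z => (M z)⁻¹ i j) z := by
  simp only [Matrix.inv_def, Ring.inverse_eq_inv', Matrix.smul_apply, smul_eq_mul,
    Matrix.adjugate_apply]
  refine ((contDiffAt_matrix_det h).inv hdet).mul (contDiffAt_matrix_det fun k l => ?_)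
  by_cases hk : k = j
  · subst hk
    simpa only [Matrix.updateRow_self] using contDiffAt_const
  · simpa only [Matrix.updateRow_ne hk] using h k l

end MatrixRegularity

section QuadraticPolynomial

variable {V : Type*} [NormedAddCommGroup V] [NormedSpace ℝ V] {R : V → ℝ} {Ω : Set V}

theorem exists_bilinForm_of_iteratedFDeriv_three_eq_zero (hΩ : IsOpen Ω) (hconn : IsConnected Ω)
    (hR : ∀ y ∈ Ω, ContDiffAt ℝ 3 R y) (hhom : ∀ (y : V) (t : ℝ), 0 < t → R (t • y) = t ^ 2 * R y)
    (hzero : ∀ y ∈ Ω, iteratedFDeriv ℝ 3 R y = 0) :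
    ∃ B : LinearMap.BilinForm ℝ V, (∀ v w, B v w = B w v) ∧ ∀ y ∈ Ω, R y = B y y := by
  obtain ⟨y₀, hy₀⟩ := hconn.nonempty
  have hR2 : ∀ y ∈ Ω, ContDiffAt ℝ 2 R y := fun y hy => (hR y hy).of_le (by norm_num)
  have hconst : ∀ y ∈ Ω, fderiv ℝ (fderiv ℝ R) y = fderiv ℝ (fderiv ℝ R) y₀ := fun y hy => by
    refine hΩ.is_const_of_fderiv_eq_zero (𝕜 := ℝ) hconn.isPreconnected (fun z hz => ?_)
      (fun z hz => norm_eq_zero.1 ?_) hy hy₀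
    · exact ((((hR z hz).fderiv_right (m := 2) (by norm_num)).fderiv_right (m := 1)
        (by norm_num)).differentiableAt (by norm_num)).differentiableWithinAt
    · rw [← norm_iteratedFDeriv_one, norm_iteratedFDeriv_fderiv, norm_iteratedFDeriv_fderiv,
        hzero z hz, norm_zero]
  refine ⟨((1 / 2 : ℝ) • fderiv ℝ (fderiv ℝ R) y₀).toBilinForm, fun v w => ?_, fun y hy => ?_⟩
  · simp [((hR2 y₀ hy₀).isSymmSndFDerivAt (by simp)).eq v w]
  · have hself := fderiv_fderiv_apply_self_of_homogeneous_two hhom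
      (differentiableAt_fderiv_of_contDiffAt_two (hR2 y hy))
    have hEuler := fderiv_apply_self_of_homogeneous_two hhom
      ((hR2 y hy).differentiableAt (by norm_num))
    rw [← hself, hconst y hy] at hEuler
    simp [hEuler]

end QuadraticPolynomial

section PartialDerivatives

variable {n : ℕ} {φ ψ : Coord n → ℝ} {x y : Coord n} {m : WithTop ℕ∞}

theorem pd_eventuallyEq (h : φ =ᶠ[𝓝 y] ψ) (i : Fin n) : pd i φ =ᶠ[𝓝 y] pd i ψ := by
  filter_upwards [h.fderiv (𝕜 := ℝ)] with z hz
  rw [pd, pd, hz]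

theorem contDiffAt_pd (h : ContDiffAt ℝ (m + 1) φ y) (i : Fin n) : ContDiffAt ℝ m (pd i φ) y :=
  (h.fderiv_right le_rfl).clm_apply contDiffAt_const

theorem pd_pd_eq (h : ContDiffAt ℝ 2 φ y) (i j : Fin n) :
    pd i (pd j φ) y
      = fderiv ℝ (fderiv ℝ φ) y (EuclideanSpace.single i 1) (EuclideanSpace.single j 1) := by
  have hj : HasFDerivAt (pd j φ) _ y :=
    (differentiableAt_fderiv_of_contDiffAt_two h).hasFDerivAt.clm_apply (hasFDerivAt_const _ y)
  rw [pd, hj.fderiv]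
  simp

theorem pd_pd_pd_eq (h : ContDiffAt ℝ 3 φ y) (i j k : Fin n) :
    pd k (pd j (pd i φ)) y = iteratedFDeriv ℝ 3 φ y ![EuclideanSpace.single k 1,
      EuclideanSpace.single j 1, EuclideanSpace.single i 1] := by
  have hji : pd j (pd i φ) =ᶠ[𝓝 y] fun z =>
      iteratedFDeriv ℝ 2 φ z ![EuclideanSpace.single j 1, EuclideanSpace.single i 1] := by
    filter_upwards [(h.of_le (m := 2) (by norm_num)).eventually (by simp)] with z hz
    rw [pd_pd_eq hz, iteratedFDeriv_two_apply]
    rfl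
  rw [(pd_eventuallyEq hji k).eq_of_nhds, pd, fderiv_continuousMultilinear_apply_const_apply
    ((h.iteratedFDeriv_right (i := 2) (m := 1) (by norm_num)).differentiableAt (by norm_num)),
    iteratedFDeriv_succ_apply_left]
  rfl

theorem iteratedFDeriv_three_eq_zero
    (h : ∀ i j k : Fin n, iteratedFDeriv ℝ 3 φ y ![EuclideanSpace.single k 1,
      EuclideanSpace.single j 1, EuclideanSpace.single i 1] = 0) :
    iteratedFDeriv ℝ 3 φ y = 0 := by
  refine ContinuousMultilinearMap.toMultilinearMap_injective
    (Module.Basis.ext_multilinear (fun _ => (EuclideanSpace.basisFun (Fin n) ℝ).toBasis)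
      fun v => ?_)
  have hv : (fun i => (EuclideanSpace.basisFun (Fin n) ℝ).toBasis (v i))
      = ![EuclideanSpace.single (v 0) 1, EuclideanSpace.single (v 1) 1,
          EuclideanSpace.single (v 2) 1] := by
    ext i : 1
    fin_cases i <;> simp
  rw [hv]
  exact h _ _ _

/-- The components `∂φ/∂xⁱ` of the differential of `φ`. -/
def partials (φ : Coord n → ℝ) (x : Coord n) : Fin n → ℝ := fun i => pd i φ x

theorem clm_apply_eq_dotProduct (L : Coord n →L[ℝ] ℝ) (v : Coord n) :
    L v = (fun i => L (EuclideanSpace.single i 1)) ⬝ᵥ v := by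
  conv_lhs => rw [← (EuclideanSpace.basisFun (Fin n) ℝ).sum_repr v]
  simp [dotProduct, mul_comm]

theorem fderiv_apply_eq_dotProduct (v : Coord n) : fderiv ℝ φ x v = partials φ x ⬝ᵥ v :=
  clm_apply_eq_dotProduct _ v

end PartialDerivatives

section Slices

variable {n : ℕ} {u : Coord n × Coord n → ℝ} {x y : Coord n} {m : WithTop ℕ∞}
  {z : Coord n × Coord n}

theorem contDiffAt_slice (h : ContDiffAt ℝ m u (x, y)) : ContDiffAt ℝ m (fun y => u (x, y)) y :=
  h.comp y (f := fun y => (x, y)) (contDiffAt_const.prodMk contDiffAt_id)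

theorem eventually_differentiableAt (h : ContDiffAt ℝ 1 u z) :
    ∀ᶠ z in 𝓝 z, DifferentiableAt ℝ u z :=
  (h.eventually (by simp)).mono fun _ hz => hz.differentiableAt (by simp)

theorem contDiffAt_pd_snd (h : ContDiffAt ℝ (m + 1) u z) (i : Fin n) :
    ContDiffAt ℝ m (fun z => pd i (fun y => u (z.1, y)) z.2) z := by
  refine ((h.fderiv_right le_rfl).clm_apply (contDiffAt_const
    (c := ((0, EuclideanSpace.single i 1) : Coord n × Coord n)))).congr_of_eventuallyEq ?_
  filter_upwards [eventually_differentiableAt (h.of_le le_add_self)] with z hz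
  have hsnd : HasFDerivAt (fun y => u (z.1, y)) _ z.2 :=
    hz.hasFDerivAt.comp z.2 (hasFDerivAt_prodMk_right z.1 z.2)
  rw [pd, hsnd.fderiv]
  simp

theorem contDiffAt_pd_fst (h : ContDiffAt ℝ (m + 1) u z) (i : Fin n) :
    ContDiffAt ℝ m (fun z => pd i (fun x => u (x, z.2)) z.1) z := by
  refine ((h.fderiv_right le_rfl).clm_apply (contDiffAt_const
    (c := ((EuclideanSpace.single i 1, 0) : Coord n × Coord n)))).congr_of_eventuallyEq ?_
  filter_upwards [eventually_differentiableAt (h.of_le le_add_self)] with z hz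
  have hfst : HasFDerivAt (fun x => u (x, z.2)) _ z.1 :=
    hz.hasFDerivAt.comp z.1 (hasFDerivAt_prodMk_left z.1 z.2)
  rw [pd, hfst.fderiv]
  simp

end Slices

section CoordinateRegularity

variable {n : ℕ} {f : Coord n → Coord n → ℝ} {m : WithTop ℕ∞} {z : Coord n × Coord n}

theorem contDiffAt_energy (h : ContDiffAt ℝ m (fun z : Coord n × Coord n => f z.1 z.2) z) :
    ContDiffAt ℝ m (fun z : Coord n × Coord n => energy f z.1 z.2) z :=
  contDiffAt_const.mul (h.pow 2)

theorem contDiffAt_gMat (h : ContDiffAt ℝ (m + 1 + 1) (fun z : Coord n × Coord n => f z.1 z.2) z)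
    (i j : Fin n) : ContDiffAt ℝ m (fun z : Coord n × Coord n => gMat f z.1 z.2 i j) z :=
  contDiffAt_pd_snd (u := fun z => pd j (energy f z.1) z.2)
    (contDiffAt_pd_snd (contDiffAt_energy h) j) i

theorem contDiffAt_spray (h : ContDiffAt ℝ (m + 1 + 1) (fun z : Coord n × Coord n => f z.1 z.2) z)
    (hdet : (gMat f z.1 z.2).det ≠ 0) (l : Fin n) :
    ContDiffAt ℝ m (fun z : Coord n × Coord n => spray f l z.1 z.2) z := by
  have hfst := contDiffAt_pd_fst (contDiffAt_energy h)
  refine contDiffAt_const.mul (ContDiffAt.sum fun i _ =>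
    (contDiffAt_matrix_inv (contDiffAt_gMat h) hdet l i).mul
      ((ContDiffAt.sum fun k _ => ContDiffAt.mul (by fun_prop) ?_).sub ?_))
  · exact contDiffAt_pd_snd (u := fun z => pd k (fun x => energy f x z.2) z.1) (hfst k) i
  · exact (hfst i).of_le le_self_add

end CoordinateRegularity

/-! ### Conformal changes and the contracted mixed curvature -/

section CoordinateFundamentalTensor

variable {n : ℕ} {f : Coord n → Coord n → ℝ} {a : Coord n → ℝ} {x y : Coord n}

theorem gMat_apply (h : ContDiffAt ℝ 2 (f x) y) (i j : Fin n) :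
    gMat f x y i j
      = fundamentalTensor (f x) y (EuclideanSpace.single i 1) (EuclideanSpace.single j 1) :=
  pd_pd_eq (contDiffAt_const.mul (h.pow 2)) i j

theorem fundamentalTensor_eq_dotProduct (h : ContDiffAt ℝ 2 (f x) y) (v w : Coord n) :
    fundamentalTensor (f x) y v w = (v ᵥ* gMat f x y) ⬝ᵥ w := by
  rw [clm_apply_eq_dotProduct]
  congr 1
  ext j
  rw [← ContinuousLinearMap.flip_apply, clm_apply_eq_dotProduct, dotProduct_comm]
  simp only [ContinuousLinearMap.flip_apply, ← gMat_apply h]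
  rfl

theorem fundamentalTensor_self_pos (h : ContDiffAt ℝ 2 (f x) y) (hpos : (gMat f x y).PosDef)
    {X : Coord n} (hX : X ≠ 0) : 0 < fundamentalTensor (f x) y X X := by
  rw [fundamentalTensor_eq_dotProduct h, ← Matrix.dotProduct_mulVec]
  exact hpos.dotProduct_mulVec_pos (x := X) fun h => hX (WithLp.ofLp_injective 2 h)

namespace IsMinkowskiNorm

theorem posDef_gMat (hF : IsMinkowskiNorm (f x)) (hy : y ≠ 0) : (gMat f x y).PosDef := by
  refine .of_dotProduct_mulVec_pos (Matrix.IsHermitian.ext fun i j => ?_) fun X hX => ?_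
  · rw [gMat_apply (hF.contDiffAt y hy), gMat_apply (hF.contDiffAt y hy),
      hF.fundamentalTensor_symm hy, star_trivial]
  · have h := hF.posDef y hy (WithLp.toLp 2 X) fun h => hX (congrArg WithLp.ofLp h)
    rwa [fundamentalTensor_eq_dotProduct (hF.contDiffAt y hy), ← Matrix.dotProduct_mulVec] at h

theorem det_gMat_ne_zero (hF : IsMinkowskiNorm (f x)) (hy : y ≠ 0) : (gMat f x y).det ≠ 0 :=
  (hF.posDef_gMat hy).det_pos.ne'

end IsMinkowskiNorm

/-- The gradient of `a` at `x` for the scalar product `g_y`. -/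
def finslerGradient (f : Coord n → Coord n → ℝ) (a : Coord n → ℝ) (x y : Coord n) : Coord n :=
  WithLp.toLp 2 ((gMat f x y)⁻¹ *ᵥ partials a x)

namespace IsMinkowskiNorm

theorem fundamentalTensor_finslerGradient (hF : IsMinkowskiNorm (f x)) (hy : y ≠ 0)
    (X : Coord n) : fundamentalTensor (f x) y (finslerGradient f a x y) X = fderiv ℝ a x X := by
  rw [hF.fundamentalTensor_symm hy, fundamentalTensor_eq_dotProduct (hF.contDiffAt y hy),
    ← Matrix.dotProduct_mulVec, finslerGradient, Matrix.mulVec_mulVec,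
    Matrix.mul_nonsing_inv _ (isUnit_iff_ne_zero.2 (hF.det_gMat_ne_zero hy)), Matrix.one_mulVec,
    dotProduct_comm, fderiv_apply_eq_dotProduct]

theorem inv_gMat_mulVec_partials_energy (hF : IsMinkowskiNorm (f x)) (hy : y ≠ 0) :
    (gMat f x y)⁻¹ *ᵥ partials (energy f x) y = y := by
  have h : partials (energy f x) y = gMat f x y *ᵥ y := by
    refine dotProduct_eq _ _ fun v => ?_
    have h := fundamentalTensor_eq_dotProduct (hF.contDiffAt y hy) (WithLp.toLp 2 v) y
    rw [hF.fundamentalTensor_symm hy, hF.fundamentalTensor_apply_self hy,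
      fderiv_apply_eq_dotProduct, ← Matrix.dotProduct_mulVec] at h
    exact h.trans (dotProduct_comm _ _)
  rw [h, Matrix.mulVec_mulVec,
    Matrix.nonsing_inv_mul _ (isUnit_iff_ne_zero.2 (hF.det_gMat_ne_zero hy)), Matrix.one_mulVec]

end IsMinkowskiNorm

end CoordinateFundamentalTensor

section ConformalChange

variable {n : ℕ} {f : Coord n → Coord n → ℝ} {a : Coord n → ℝ} {x y : Coord n}

/-- The conformal change `e^a F` in induced coordinates. -/
def conformalCoord (a : Coord n → ℝ) (f : Coord n → Coord n → ℝ) (x y : Coord n) : ℝ :=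
  Real.exp (a x) * f x y

/-- The covector `yᵏ ∂²E/∂yᵐ∂xᵏ - ∂E/∂xᵐ` to which half of `gˡᵐ` is applied in the spray. -/
def sprayCovector (f : Coord n → Coord n → ℝ) (x y : Coord n) (m : Fin n) : ℝ :=
  ∑ k, y k * pd m (fun y' => pd k (fun x' => energy f x' y') x) y
    - pd m (fun x' => energy f x' y) x

theorem spray_eq_mulVec (l : Fin n) :
    spray f l x y = 1 / 2 * ((gMat f x y)⁻¹ *ᵥ sprayCovector f x y) l := rfl

theorem energy_conformalCoord (x y : Coord n) :
    energy (conformalCoord a f) x y = Real.exp (a x) ^ 2 * energy f x y := by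
  simp only [energy, conformalCoord]; ring

theorem pd_const_mul (c : ℝ) (φ : Coord n → ℝ) (i : Fin n) (y : Coord n) :
    pd i (fun y => c * φ y) y = c * pd i φ y := by
  have h := congrFun (fderiv_const_smul_field (𝕜 := ℝ) (f := φ) c) y
  exact DFunLike.congr_fun h _

theorem gMat_conformalCoord (x y : Coord n) :
    gMat (conformalCoord a f) x y = Real.exp (a x) ^ 2 • gMat f x y := by
  ext i j
  simp only [gMat, Matrix.of_apply, Matrix.smul_apply, smul_eq_mul, energy_conformalCoord,
    pd_const_mul]

theorem pd_exp_sq_mul {φ : Coord n → ℝ} (ha : DifferentiableAt ℝ a x)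
    (hφ : DifferentiableAt ℝ φ x) (k : Fin n) :
    pd k (fun x' => Real.exp (a x') ^ 2 * φ x') x
      = Real.exp (a x) ^ 2 * (2 * pd k a x * φ x + pd k φ x) := by
  have h : HasFDerivAt (fun x' => Real.exp (a x') ^ 2 * φ x') _ x :=
    (ha.hasFDerivAt.exp.pow 2).mul hφ.hasFDerivAt
  rw [pd, h.fderiv]
  simp [pd]
  ring

theorem pd_pd_energy_conformalCoord
    (h : ContDiffAt ℝ 2 (fun z : Coord n × Coord n => f z.1 z.2) (x, y))
    (ha : DifferentiableAt ℝ a x) (m k : Fin n) :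
    pd m (fun y' => pd k (fun x' => energy (conformalCoord a f) x' y') x) y
      = Real.exp (a x) ^ 2 * (2 * pd k a x * pd m (energy f x) y
        + pd m (fun y' => pd k (fun x' => energy f x' y') x) y) := by
  have hE := contDiffAt_energy h
  have hfst : (fun y' => pd k (fun x' => energy (conformalCoord a f) x' y') x) =ᶠ[𝓝 y]
      fun y' => Real.exp (a x) ^ 2 * (2 * pd k a x * energy f x y'
        + pd k (fun x' => energy f x' y') x) := by
    filter_upwards [(Continuous.prodMk_right x).tendsto y |>.eventually
      (eventually_differentiableAt (hE.of_le (by norm_num)))] with y' hy'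
    simp only [energy_conformalCoord]
    exact pd_exp_sq_mul ha (φ := fun x' => energy f x' y')
      (hy'.comp x (f := fun x' => (x', y')) (by fun_prop)) k
  have hEy : DifferentiableAt ℝ (energy f x) y :=
    (contDiffAt_slice hE).differentiableAt (by norm_num)
  have hEx : DifferentiableAt ℝ (fun y' => pd k (fun x' => energy f x' y') x) y :=
    (contDiffAt_slice (contDiffAt_pd_fst (m := 1) (hE.of_le (by norm_num)) k)).differentiableAt
      (by norm_num)
  have hadd : HasFDerivAt (fun y' => 2 * pd k a x * energy f x y'
      + pd k (fun x' => energy f x' y') x) _ y :=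
    (hEy.hasFDerivAt.const_mul (2 * pd k a x)).add hEx.hasFDerivAt
  rw [(pd_eventuallyEq hfst m).eq_of_nhds, pd_const_mul, pd, hadd.fderiv]
  rfl

theorem sprayCovector_conformalCoord
    (h : ContDiffAt ℝ 2 (fun z : Coord n × Coord n => f z.1 z.2) (x, y))
    (ha : DifferentiableAt ℝ a x) :
    sprayCovector (conformalCoord a f) x y
      = Real.exp (a x) ^ 2 • (sprayCovector f x y
        + (2 * fderiv ℝ a x y) • partials (energy f x) y - (2 * energy f x y) • partials a x) := by
  have hEx : DifferentiableAt ℝ (fun x' => energy f x' y) x :=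
    DifferentiableAt.comp x (f := fun x' => (x', y))
      ((contDiffAt_energy h).differentiableAt (by norm_num)) (by fun_prop)
  ext m
  have hsum : ∀ (c q : ℝ) (p r : Fin n → ℝ), ∑ k, y k * (c * (2 * p k * q + r k))
      = c * (2 * (∑ k, p k * y k) * q + ∑ k, y k * r k) := fun c q p r => by
    simp only [Finset.mul_sum, Finset.sum_mul, ← Finset.sum_add_distrib]
    exact Finset.sum_congr rfl fun k _ => by ring
  simp only [sprayCovector, pd_pd_energy_conformalCoord h ha]
  simp only [energy_conformalCoord, pd_exp_sq_mul ha hEx, fderiv_apply_eq_dotProduct, partials,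
    dotProduct, Pi.smul_apply, Pi.add_apply, Pi.sub_apply, smul_eq_mul, hsum]
  rw [sprayCovector]
  ring

theorem inv_gMat_conformalCoord (hdet : (gMat f x y).det ≠ 0) :
    (gMat (conformalCoord a f) x y)⁻¹ = (Real.exp (a x) ^ 2)⁻¹ • (gMat f x y)⁻¹ := by
  rw [gMat_conformalCoord]
  exact Matrix.inv_smul' (A := gMat f x y)
    (Units.mk0 (Real.exp (a x) ^ 2) (pow_ne_zero 2 (Real.exp_ne_zero _)))
    (isUnit_iff_ne_zero.2 hdet)

theorem spray_conformalCoord_sub (hF : IsMinkowskiNorm (f x)) (hy : y ≠ 0)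
    (h : ContDiffAt ℝ 2 (fun z : Coord n × Coord n => f z.1 z.2) (x, y))
    (ha : DifferentiableAt ℝ a x) (l : Fin n) :
    spray (conformalCoord a f) l x y - spray f l x y
      = fderiv ℝ a x y * y l - energy f x y * finslerGradient f a x y l := by
  rw [spray_eq_mulVec, spray_eq_mulVec, inv_gMat_conformalCoord (hF.det_gMat_ne_zero hy),
    sprayCovector_conformalCoord h ha, Matrix.smul_mulVec, Matrix.mulVec_smul,
    inv_smul_smul₀ (pow_ne_zero 2 (Real.exp_ne_zero _)), Matrix.mulVec_sub, Matrix.mulVec_add,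
    Matrix.mulVec_smul, Matrix.mulVec_smul, hF.inv_gMat_mulVec_partials_energy hy]
  simp only [finslerGradient, Pi.sub_apply, Pi.add_apply, Pi.smul_apply, smul_eq_mul]
  ring

end ConformalChange

section QuadraticDualNorm

variable {n : ℕ} {f : Coord n → Coord n → ℝ} {a : Coord n → ℝ} {x y : Coord n}

/-- The function `F² |da|²` on the tangent bundle in induced coordinates, where `|da|` is the
length of the differential of `a` for the fundamental tensor. -/
def dualNormForm (f : Coord n → Coord n → ℝ) (a : Coord n → ℝ) (x y : Coord n) : ℝ :=
  f x y ^ 2 * fderiv ℝ a x (finslerGradient f a x y)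

theorem sum_spray_conformalCoord_sub (hF : IsMinkowskiNorm (f x)) (hy : y ≠ 0)
    (h : ContDiffAt ℝ 2 (fun z : Coord n × Coord n => f z.1 z.2) (x, y))
    (ha : DifferentiableAt ℝ a x) :
    ∑ l, partials a x l * (spray (conformalCoord a f) l x y - spray f l x y)
      = fderiv ℝ a x y ^ 2 - 1 / 2 * dualNormForm f a x y := by
  have hsub : ∀ l, partials a x l * (spray (conformalCoord a f) l x y - spray f l x y)
      = fderiv ℝ a x y * (partials a x l * y l)
        - energy f x y * (partials a x l * finslerGradient f a x y l) := fun l => by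
    rw [spray_conformalCoord_sub hF hy h ha]; ring
  simp only [hsub, Finset.sum_sub_distrib, ← Finset.mul_sum]
  rw [← dotProduct, ← dotProduct, ← fderiv_apply_eq_dotProduct, ← fderiv_apply_eq_dotProduct,
    dualNormForm, energy]
  ring

theorem contDiffAt_dualNormForm {m : WithTop ℕ∞} {z : Coord n × Coord n}
    (h : ContDiffAt ℝ (m + 1 + 1) (fun z : Coord n × Coord n => f z.1 z.2) z)
    (hdet : (gMat f z.1 z.2).det ≠ 0) (ha : ContDiffAt ℝ (m + 1) a z.1) :
    ContDiffAt ℝ m (fun z : Coord n × Coord n => dualNormForm f a z.1 z.2) z := by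
  have hgrad : ContDiffAt ℝ m (fun z : Coord n × Coord n => finslerGradient f a z.1 z.2) z := by
    refine contDiffAt_euclidean.2 fun l => ?_
    simp only [finslerGradient, Matrix.mulVec, dotProduct]
    exact ContDiffAt.sum fun k _ => (contDiffAt_matrix_inv (contDiffAt_gMat h) hdet l k).mul
      ((contDiffAt_pd ha k).comp z contDiffAt_fst)
  exact ((h.of_le (le_self_add.trans le_self_add)).pow 2).mul
    (((ha.fderiv_right le_rfl).comp z contDiffAt_fst).clm_apply hgrad)

/-- The conditions at the point `x` that a Finsler metric `F` and a conformal change `e^a F`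
preserving the contracted mixed curvature impose on the coordinate expressions. -/
structure IsContractedInvariantAt (f : Coord n → Coord n → ℝ) (a : Coord n → ℝ)
    (x : Coord n) : Prop where
  isMinkowskiNorm : IsMinkowskiNorm (f x)
  contDiffAt_two : ∀ y, y ≠ 0 → ContDiffAt ℝ 2 (fun z : Coord n × Coord n => f z.1 z.2) (x, y)
  contDiffAt_factor : ContDiffAt ℝ ∞ a x
  invariant : ∃ d : Coord n, ∀ y, y ∉ Submodule.span ℝ {d} →
    ContDiffAt ℝ ∞ (fun z : Coord n × Coord n => f z.1 z.2) (x, y) ∧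
    ∀ i j k, ∑ l, berwaldP (conformalCoord a f) l i j k x y * pd l a x
        = ∑ l, berwaldP f l i j k x y * pd l a x

namespace IsContractedInvariantAt

theorem iteratedFDeriv_three_eq_zero (H : IsContractedInvariantAt f a x) (hy : y ≠ 0)
    (hreg : ContDiffAt ℝ ∞ (fun z : Coord n × Coord n => f z.1 z.2) (x, y))
    (hinv : ∀ i j k, ∑ l, berwaldP (conformalCoord a f) l i j k x y * pd l a x
        = ∑ l, berwaldP f l i j k x y * pd l a x) :
    iteratedFDeriv ℝ 3 (fun y => fderiv ℝ a x y ^ 2 - 1 / 2 * dualNormForm f a x y) y = 0 := by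
  have hdet := H.isMinkowskiNorm.det_gMat_ne_zero hy
  have hspray : ∀ l, ContDiffAt ℝ 3 (spray f l x) y := fun l =>
    (contDiffAt_slice (contDiffAt_spray (m := ∞) hreg hdet l)).of_le ENat.LEInfty.out
  have hconf : ∀ l, ContDiffAt ℝ 3 (spray (conformalCoord a f) l x) y := fun l => by
    refine (contDiffAt_slice (contDiffAt_spray (m := ∞) ?_ ?_ l)).of_le ENat.LEInfty.out
    · exact (H.contDiffAt_factor.comp (x, y) contDiffAt_fst).exp.mul hreg
    · rw [gMat_conformalCoord, Matrix.det_smul]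
      exact mul_ne_zero (pow_ne_zero _ (pow_ne_zero 2 (Real.exp_ne_zero _))) hdet
  have hR : (fun y => fderiv ℝ a x y ^ 2 - 1 / 2 * dualNormForm f a x y) =ᶠ[𝓝 y]
      fun y => ∑ l, partials a x l • (spray (conformalCoord a f) l x y - spray f l x y) := by
    filter_upwards [isOpen_ne.mem_nhds hy] with z hz
    exact (sum_spray_conformalCoord_sub H.isMinkowskiNorm hz (H.contDiffAt_two z hz)
      (H.contDiffAt_factor.differentiableAt (by simp))).symm
  refine FinslerConformal.iteratedFDeriv_three_eq_zero fun i j k => ?_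
  have hterm_smooth : ∀ l ∈ Finset.univ, ContDiffAt ℝ 3 (fun y => partials a x l •
      (spray (conformalCoord a f) l x y - spray f l x y)) y := fun l _ =>
    ((hconf l).sub (hspray l)).const_smul _
  rw [(hR.iteratedFDeriv ℝ 3).eq_of_nhds, iteratedFDeriv_fun_sum_apply hterm_smooth,
    sum_apply]
  have hterm : ∀ l, iteratedFDeriv ℝ 3 (fun y => partials a x l •
      (spray (conformalCoord a f) l x y - spray f l x y)) y ![EuclideanSpace.single k 1,
        EuclideanSpace.single j 1, EuclideanSpace.single i 1]
      = berwaldP f l i j k x y * pd l a x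
        - berwaldP (conformalCoord a f) l i j k x y * pd l a x := fun l => by
    rw [iteratedFDeriv_const_smul_apply' ((hconf l).sub (hspray l)),
      fun_iteratedFDeriv_sub_apply (hconf l) (hspray l), smul_apply,
      sub_apply, ← pd_pd_pd_eq (hconf l), ← pd_pd_pd_eq (hspray l)]
    simp only [partials, berwaldP, smul_eq_mul]
    ring
  simp only [hterm, Finset.sum_sub_distrib, hinv i j k, sub_self]

theorem continuousAt_dualNormForm (H : IsContractedInvariantAt f a x) (hy : y ≠ 0) :
    ContinuousAt (dualNormForm f a x) y :=
  (contDiffAt_slice (contDiffAt_dualNormForm (m := 0) ((H.contDiffAt_two y hy).of_le (by norm_num))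
    (H.isMinkowskiNorm.det_gMat_ne_zero hy)
    (H.contDiffAt_factor.of_le (by simp)))).continuousAt

theorem dualNormForm_smul (H : IsContractedInvariantAt f a x) (y : Coord n) {t : ℝ} (ht : 0 < t) :
    dualNormForm f a x (t • y) = t ^ 2 * dualNormForm f a x y := by
  rcases eq_or_ne y 0 with rfl | hy
  · simp [dualNormForm, H.isMinkowskiNorm.apply_zero]
  have hty := smul_ne_zero ht.ne' hy
  have hg : gMat f x (t • y) = gMat f x y := by
    ext i j
    rw [gMat_apply (H.isMinkowskiNorm.contDiffAt _ hty),
      gMat_apply (H.isMinkowskiNorm.contDiffAt _ hy), H.isMinkowskiNorm.fundamentalTensor_smul ht]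
  rw [dualNormForm, dualNormForm, finslerGradient, finslerGradient, hg,
    H.isMinkowskiNorm.smul y t ht]
  ring

theorem exists_bilinForm_eqOn (hn : 3 ≤ n) (H : IsContractedInvariantAt f a x) :
    ∃ (L : Submodule ℝ (Coord n)) (B : LinearMap.BilinForm ℝ (Coord n)), L ≠ ⊤ ∧
      (∀ v w, B v w = B w v) ∧
      ∀ y ∉ L, fderiv ℝ a x y ^ 2 - 1 / 2 * dualNormForm f a x y = B y y := by
  obtain ⟨d, hd⟩ := H.invariant
  set L : Submodule ℝ (Coord n) := Submodule.span ℝ {d}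
  have hcodim : 1 < Module.finrank ℝ (Coord n ⧸ L) := by
    have h1 := Submodule.finrank_quotient_add_finrank L
    have h2 : Module.finrank ℝ L ≤ 1 :=
      (finrank_span_le_card ({d} : Set (Coord n))).trans (by simp)
    rw [finrank_euclideanSpace_fin] at h1
    omega
  have hL : L ≠ ⊤ := by
    rintro h
    rw [h, Module.finrank_zero_of_subsingleton] at hcodim
    omega
  have hne : ∀ y ∈ (L : Set (Coord n))ᶜ, y ≠ 0 := by
    rintro y hy rfl
    exact hy L.zero_mem
  set R : Coord n → ℝ := fun y => fderiv ℝ a x y ^ 2 - 1 / 2 * dualNormForm f a x y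
  have hsmooth : ∀ y ∈ (L : Set (Coord n))ᶜ, ContDiffAt ℝ 3 R y := fun y hy =>
    (((fderiv ℝ a x).contDiff.contDiffAt).pow 2).sub (contDiffAt_const.mul
      ((contDiffAt_slice (contDiffAt_dualNormForm (m := ∞) (hd y hy).1
        (H.isMinkowskiNorm.det_gMat_ne_zero (hne y hy)) H.contDiffAt_factor)).of_le
          ENat.LEInfty.out))
  have hhom : ∀ (y : Coord n) (t : ℝ), 0 < t → R (t • y) = t ^ 2 * R y := fun y t ht => by
    simp only [R, map_smul, smul_eq_mul, H.dualNormForm_smul y ht]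
    ring
  obtain ⟨B, hB, hR⟩ := exists_bilinForm_of_iteratedFDeriv_three_eq_zero
    (Submodule.closed_of_finiteDimensional L).isOpen_compl
    (isConnected_compl_of_one_lt_codim (Module.lt_rank_of_lt_finrank hcodim)) hsmooth hhom
    fun y hy => H.iteratedFDeriv_three_eq_zero (hne y hy) (hd y hy).1 (hd y hy).2
  exact ⟨L, B, hL, hB, hR⟩

theorem exists_hasQuadraticDualNorm (hn : 3 ≤ n) (H : IsContractedInvariantAt f a x)
    (hη : fderiv ℝ a x ≠ 0) :
    ∃ A : LinearMap.BilinForm ℝ (Coord n), HasQuadraticDualNorm (f x) (fderiv ℝ a x) A := by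
  obtain ⟨L, B, hL, hB, hBL⟩ := H.exists_bilinForm_eqOn hn
  set η := fderiv ℝ a x
  have hdense : Dense (L : Set (Coord n))ᶜ := interior_eq_empty_iff_dense_compl.1 <|
    not_nonempty_iff_eq_empty.1 fun h => hL (L.eq_top_of_nonempty_interior' h)
  have hR : ∀ y, y ≠ 0 → η y ^ 2 - 1 / 2 * dualNormForm f a x y = B y y := fun y hy => by
    have hleft : ContinuousAt (fun y => η y ^ 2 - 1 / 2 * dualNormForm f a x y) y :=
      (η.continuous.continuousAt.pow 2).sub
        (continuousAt_const.mul (H.continuousAt_dualNormForm hy))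
    have hright : ContinuousAt (fun y => B y y) y :=
      (B.toContinuousBilinearMap.continuous.clm_apply continuous_id).continuousAt
    exact tendsto_nhds_unique_of_frequently_eq hleft hright
      ((mem_closure_iff_frequently.1 (hdense y)).mono hBL)
  refine ⟨(2 : ℝ) • (LinearMap.BilinForm.linMulLin η.toLinearMap η.toLinearMap - B),
    H.isMinkowskiNorm, hη, fun v w => ?_, fun y hy => ?_⟩
  · simp [hB v w, mul_comm]
  · refine ⟨finslerGradient f a x y, H.isMinkowskiNorm.fundamentalTensor_finslerGradient hy, ?_⟩
    have h := hR y hy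
    rw [dualNormForm] at h
    simp
    linarith

end IsContractedInvariantAt

end QuadraticDualNorm

/-! ### Smooth dependence on the base point -/

section FinsleroidParameters

variable {V : Type*} [NormedAddCommGroup V] [NormedSpace ℝ V] {F : V → ℝ} {η : V →L[ℝ] ℝ}
  {A : LinearMap.BilinForm ℝ V} {g ρ : ℝ} {v w : V}

/-- For `F = e^ρ F₀`, with `F₀` a Finsleroid norm with scalar product `A`, and for `v`
annihilated by the axis, dual to `w`, this is the parameter `g` of `F₀`. -/
def axialParameter (F : V → ℝ) (A : LinearMap.BilinForm ℝ V) (w v : V) : ℝ :=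
  √(A v v) * fderiv ℝ F v w / F v

/-- For `F = e^ρ F₀`, with `F₀` the Finsleroid norm with scalar product `A` and parameter `g`, and
for `v` annihilated by the axis, this is the exponent `ρ`. -/
def conformalExponent (F : V → ℝ) (A : LinearMap.BilinForm ℝ V) (g : ℝ) (v : V) : ℝ :=
  Real.log (F v / √(A v v))
    - g / √(1 - g ^ 2 / 4) * Real.arctan (g / √(1 - g ^ 2 / 4) / 2) / 2

theorem transverseForm_self_of_apply_eq_zero (hηv : η v = 0) :
    transverseForm A η v v = A v v := by
  rw [transverseForm_apply, hηv, mul_zero, sub_zero]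

namespace IsUnitForm

theorem transverseForm_add_smul_dual (hA : IsUnitForm A η) (hw : ∀ u, A w u = η u)
    (hw1 : η w = 1) (hηv : η v = 0) (t : ℝ) :
    transverseForm A η (v + t • w) (v + t • w) = A v v := by
  simp only [transverseForm_apply, map_add, map_smul, LinearMap.add_apply, LinearMap.smul_apply,
    smul_eq_mul, hA.symm v w, hw, hηv, hw1]
  ring

theorem axialParameter_eq (hA : IsUnitForm A η) (hg : g ∈ Ioo (-2) 2)
    (hF : ∀ y, F y = Real.exp ρ * finsleroidNorm g A η y) (hd : DifferentiableAt ℝ F v)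
    (hw : ∀ u, A w u = η u) (hw1 : η w = 1) (hv : v ≠ 0) (hηv : η v = 0) :
    axialParameter F A w v = g := by
  have hq : 0 < √(A v v) := Real.sqrt_pos.2 (hA.pos v hv)
  have hFv : F v = Real.exp ρ * finsleroidFun g 0 √(A v v) := by
    rw [hF, finsleroidNorm, hηv, transverseForm_self_of_apply_eq_zero hηv]
  have hFpos : 0 < F v := hFv ▸ mul_pos (Real.exp_pos ρ) (finsleroidFun_pos hg (.inr hq.ne'))
  have hline : (fun t : ℝ => 1 / 2 * F (v + t • w) ^ 2)
      = fun t => Real.exp ρ ^ 2 * (1 / 2 * finsleroidFun g t √(A v v) ^ 2) := by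
    ext t
    rw [hF, finsleroidNorm, hA.transverseForm_add_smul_dual hw hw1 hηv, map_add, map_smul, hηv,
      hw1, smul_eq_mul, mul_one, zero_add]
    ring
  have hderiv : HasDerivAt (fun t : ℝ => 1 / 2 * F (v + t • w) ^ 2) (F v * fderiv ℝ F v w) 0 := by
    have hd0 : HasFDerivAt F (fderiv ℝ F v) (v + (0 : ℝ) • w) := by
      simpa using hd.hasFDerivAt
    refine (((hd0.comp_hasDerivAt 0 (hasDerivAt_line v w 0)).pow 2).const_mul
      (1 / 2)).congr_deriv ?_
    simp
    ring
  have hderiv' := (hasDerivAt_half_finsleroidFun_sq hg (hasDerivAt_id (0 : ℝ))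
    (hasDerivAt_const (0 : ℝ) √(A v v)) hq).const_mul (Real.exp ρ ^ 2)
  have hFd := (hline ▸ hderiv).unique hderiv'
  have hFsq : F v ^ 2 = Real.exp ρ ^ 2 * (finsleroidFactor g 0 √(A v v) * √(A v v) ^ 2) := by
    rw [hFv, mul_pow, finsleroidFun_sq hg 0 hq.le, finsleroidQuad]
    ring
  simp only [id, zero_add, mul_zero, add_zero, mul_one] at hFd
  rw [axialParameter, div_eq_iff hFpos.ne']
  refine mul_left_cancel₀ hFpos.ne' ?_
  calc F v * (√(A v v) * fderiv ℝ F v w) = √(A v v) * (F v * fderiv ℝ F v w) := by ring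
    _ = g * F v ^ 2 := by rw [hFsq, hFd]; ring
    _ = F v * (g * F v) := by ring

theorem conformalExponent_eq (hA : IsUnitForm A η)
    (hF : ∀ y, F y = Real.exp ρ * finsleroidNorm g A η y) (hv : v ≠ 0) (hηv : η v = 0) :
    conformalExponent F A g v = ρ := by
  have hq : 0 < √(A v v) := Real.sqrt_pos.2 (hA.pos v hv)
  have hquot : F v / √(A v v) = Real.exp (ρ + g / √(1 - g ^ 2 / 4) *
      Real.arctan (g / √(1 - g ^ 2 / 4) / 2) / 2) := by
    rw [div_eq_iff hq.ne', hF, finsleroidNorm, hηv, transverseForm_self_of_apply_eq_zero hηv,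
      Real.exp_add]
    simp [finsleroidFun, finsleroidAngle, Real.sqrt_sq hq.le, mul_assoc]
  rw [conformalExponent, hquot, Real.log_exp, add_sub_cancel_right]

end IsUnitForm

end FinsleroidParameters

section SmoothForms

variable {W : Type*} [NormedAddCommGroup W] [NormedSpace ℝ W] {m : WithTop ℕ∞}

theorem eventually_contDiffAt_apply_of_quadratic {V : Type*} [NormedAddCommGroup V]
    [NormedSpace ℝ V] {A : W → LinearMap.BilinForm ℝ V} {x₀ : W} {v₀ : V}
    (hsymm : ∀ᶠ x in 𝓝 x₀, ∀ v w, A x v w = A x w v)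
    (h : ∀ᶠ y in 𝓝 v₀, ∀ᶠ x in 𝓝 x₀, ContDiffAt ℝ m (fun x => A x y y) x) (v w : V) :
    ∀ᶠ x in 𝓝 x₀, ContDiffAt ℝ m (fun x => A x v w) x := by
  have hline : ∀ u, ∀ᶠ t in 𝓝[≠] (0 : ℝ), ∀ᶠ x in 𝓝 x₀,
      ContDiffAt ℝ m (fun x => A x (v₀ + t • u) (v₀ + t • u)) x := fun u =>
    ((tendsto_line v₀ u).eventually h).filter_mono nhdsWithin_le_nhds
  obtain ⟨t, ⟨⟨⟨hvw, hv⟩, hw⟩, ht⟩⟩ := ((((hline (v + w)).and (hline v)).and (hline w)).and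
    self_mem_nhdsWithin).exists
  have ht : t ≠ 0 := ht
  filter_upwards [hvw, hv, hw, h.self_of_nhds, hsymm.eventually_nhds] with x hvw hv hw h₀ hs
  have hpolar : ∀ᶠ x in 𝓝 x, A x v w = 1 / (2 * t ^ 2) *
      (A x (v₀ + t • (v + w)) (v₀ + t • (v + w)) - A x (v₀ + t • v) (v₀ + t • v)
        - A x (v₀ + t • w) (v₀ + t • w) + A x v₀ v₀) := by
    filter_upwards [hs] with x hs
    simp only [map_add, map_smul, LinearMap.add_apply, LinearMap.smul_apply, smul_eq_mul,
      hs _ v₀, hs w v]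
    field_simp
    ring
  exact (contDiffAt_const.mul (((hvw.sub hv).sub hw).add h₀)).congr_of_eventuallyEq hpolar

variable {n : ℕ}

/-- The matrix of a bilinear form in the standard basis. -/
def stdMatrix (B : LinearMap.BilinForm ℝ (Coord n)) : Matrix (Fin n) (Fin n) ℝ :=
  LinearMap.BilinForm.toMatrix (EuclideanSpace.basisFun (Fin n) ℝ).toBasis B

theorem stdMatrix_apply (B : LinearMap.BilinForm ℝ (Coord n)) (i j : Fin n) :
    stdMatrix B i j = B (EuclideanSpace.single i 1) (EuclideanSpace.single j 1) := by
  simp [stdMatrix, LinearMap.BilinForm.toMatrix_apply]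

theorem bilinForm_apply_eq_dotProduct (B : LinearMap.BilinForm ℝ (Coord n)) (v w : Coord n) :
    B v w = v ⬝ᵥ stdMatrix B *ᵥ w :=
  B.apply_eq_dotProduct_toMatrix_mulVec (EuclideanSpace.basisFun (Fin n) ℝ).toBasis v w

theorem det_stdMatrix_ne_zero {B : LinearMap.BilinForm ℝ (Coord n)}
    (h : ∀ y, y ≠ 0 → 0 < B y y) : (stdMatrix B).det ≠ 0 := by
  intro h0
  obtain ⟨v, hv, hBv⟩ := Matrix.exists_mulVec_eq_zero_iff.2 h0
  have hpos := h (WithLp.toLp 2 v) fun h => hv (congrArg WithLp.ofLp h)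
  rw [bilinForm_apply_eq_dotProduct, hBv, dotProduct_zero] at hpos
  exact lt_irrefl _ hpos

/-- The gradient of `a` at `x` for the scalar product `B`. -/
def formGradient (B : LinearMap.BilinForm ℝ (Coord n)) (a : Coord n → ℝ) (x : Coord n) :
    Coord n :=
  WithLp.toLp 2 ((stdMatrix B)⁻¹ *ᵥ partials a x)

section Gradient

variable {B : LinearMap.BilinForm ℝ (Coord n)} {a : Coord n → ℝ} {x : Coord n}

theorem IsUnitForm.apply_formGradient (hB : IsUnitForm B (fderiv ℝ a x)) (v : Coord n) :
    B (formGradient B a x) v = fderiv ℝ a x v := by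
  rw [hB.symm, bilinForm_apply_eq_dotProduct, formGradient, Matrix.mulVec_mulVec,
    Matrix.mul_nonsing_inv _ (isUnit_iff_ne_zero.2 (det_stdMatrix_ne_zero hB.pos)),
    Matrix.one_mulVec, dotProduct_comm, fderiv_apply_eq_dotProduct]

theorem IsUnitForm.fderiv_formGradient (hB : IsUnitForm B (fderiv ℝ a x)) :
    fderiv ℝ a x (formGradient B a x) = 1 := by
  obtain ⟨w, hw, hw1⟩ := hB.exists_dual
  rw [← hw, hB.symm, hB.apply_formGradient, hw1]

end Gradient

variable {A : W → LinearMap.BilinForm ℝ (Coord n)} {z : W}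

theorem contDiffAt_bilinForm_apply {v w : W → Coord n}
    (hA : ∀ i j, ContDiffAt ℝ m (fun z => stdMatrix (A z) i j) z) (hv : ContDiffAt ℝ m v z)
    (hw : ContDiffAt ℝ m w z) : ContDiffAt ℝ m (fun z => A z (v z) (w z)) z := by
  simp only [bilinForm_apply_eq_dotProduct, Matrix.mulVec, dotProduct]
  exact ContDiffAt.sum fun i _ => (contDiffAt_euclidean.1 hv i).mul <|
    ContDiffAt.sum fun j _ => (hA i j).mul (contDiffAt_euclidean.1 hw j)

theorem contDiffAt_formGradient {A : Coord n → LinearMap.BilinForm ℝ (Coord n)}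
    {a : Coord n → ℝ} {x : Coord n} (hA : ∀ i j, ContDiffAt ℝ m (fun x => stdMatrix (A x) i j) x)
    (hdet : (stdMatrix (A x)).det ≠ 0) (ha : ContDiffAt ℝ (m + 1) a x) :
    ContDiffAt ℝ m (fun x => formGradient (A x) a x) x := by
  refine contDiffAt_euclidean.2 fun i => ?_
  simp only [formGradient, Matrix.mulVec, dotProduct]
  exact ContDiffAt.sum fun j _ => (contDiffAt_matrix_inv hA hdet i j).mul (contDiffAt_pd ha j)

end SmoothForms

section SmoothParameters

variable {n : ℕ} {f : Coord n → Coord n → ℝ} {a : Coord n → ℝ}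
  {A : Coord n → LinearMap.BilinForm ℝ (Coord n)} {x : Coord n} {v w : Coord n → Coord n}
  {g : Coord n → ℝ}

theorem contDiffAt_sqrt_apply_self (hA : ∀ i j, ContDiffAt ℝ ∞ (fun x => stdMatrix (A x) i j) x)
    (hv : ContDiffAt ℝ ∞ v x) (hpos : 0 < A x (v x) (v x)) :
    ContDiffAt ℝ ∞ (fun x => √(A x (v x) (v x))) x :=
  (contDiffAt_bilinForm_apply hA hv hv).sqrt hpos.ne'

theorem contDiffAt_axialParameter
    (hf : ContDiffAt ℝ ∞ (fun z : Coord n × Coord n => f z.1 z.2) (x, v x))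
    (hA : ∀ i j, ContDiffAt ℝ ∞ (fun x => stdMatrix (A x) i j) x) (hv : ContDiffAt ℝ ∞ v x)
    (hw : ContDiffAt ℝ ∞ w x) (hpos : 0 < A x (v x) (v x)) (hfpos : f x (v x) ≠ 0) :
    ContDiffAt ℝ ∞ (fun x => axialParameter (f x) (A x) (w x) (v x)) x :=
  ((contDiffAt_sqrt_apply_self hA hv hpos).mul
    ((ContDiffAt.fderiv (m := ∞) hf hv (by simp)).clm_apply hw)).div
    (hf.comp x (f := fun x => (x, v x)) (contDiffAt_id.prodMk hv)) hfpos

theorem contDiffAt_conformalExponent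
    (hf : ContDiffAt ℝ ∞ (fun z : Coord n × Coord n => f z.1 z.2) (x, v x))
    (hA : ∀ i j, ContDiffAt ℝ ∞ (fun x => stdMatrix (A x) i j) x) (hv : ContDiffAt ℝ ∞ v x)
    (hg : ContDiffAt ℝ ∞ g x) (hgx : g x ∈ Ioo (-2) 2) (hpos : 0 < A x (v x) (v x))
    (hfpos : 0 < f x (v x)) :
    ContDiffAt ℝ ∞ (fun x => conformalExponent (f x) (A x) (g x) (v x)) x := by
  have hq : 0 < √(A x (v x) (v x)) := Real.sqrt_pos.2 hpos
  have hG : ContDiffAt ℝ ∞ (fun x => g x / √(1 - g x ^ 2 / 4)) x :=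
    hg.div ((contDiffAt_const.sub ((hg.pow 2).div_const 4)).sqrt
      (one_sub_sq_div_four_pos hgx).ne') (sqrt_one_sub_sq_div_four_pos hgx).ne'
  have hquot : ContDiffAt ℝ ∞ (fun x => f x (v x) / √(A x (v x) (v x))) x :=
    (hf.comp x (f := fun x => (x, v x)) (contDiffAt_id.prodMk hv)).div
      (contDiffAt_sqrt_apply_self hA hv hpos) hq.ne'
  exact (hquot.log (div_pos hfpos hq).ne').sub
    ((hG.mul (hG.div_const 2).arctan).div_const 2)

end SmoothParameters

section SmoothFinsleroidData

variable {n : ℕ} {f : Coord n → Coord n → ℝ} {a : Coord n → ℝ}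
  {A : Coord n → LinearMap.BilinForm ℝ (Coord n)} {x x₀ v₀ : Coord n}

theorem HasQuadraticDualNorm.dualNormForm_eq {B : LinearMap.BilinForm ℝ (Coord n)} {y : Coord n}
    (h : HasQuadraticDualNorm (f x) (fderiv ℝ a x) B) (hy : y ≠ 0) :
    dualNormForm f a x y = B y y := by
  obtain ⟨W, hW, hWB⟩ := h.quadratic y hy
  rw [dualNormForm, ← hWB, ← hW, h.isMinkowskiNorm.fundamentalTensor_symm hy,
    h.isMinkowskiNorm.fundamentalTensor_finslerGradient hy]

theorem eventually_contDiffAt_stdMatrix (ha : ∀ᶠ x in 𝓝 x₀, ContDiffAt ℝ ∞ a x)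
    (hA : ∀ᶠ x in 𝓝 x₀, HasQuadraticDualNorm (f x) (fderiv ℝ a x) (A x)) (hv₀ : v₀ ≠ 0)
    (hreg : ∀ᶠ z in 𝓝 (x₀, v₀), ContDiffAt ℝ ∞ (fun z : Coord n × Coord n => f z.1 z.2) z) :
    ∀ᶠ x in 𝓝 x₀, ∀ i j, ContDiffAt ℝ ∞ (fun x => stdMatrix (A x) i j) x := by
  have hswap : ∀ᶠ z in 𝓝 (v₀, x₀), ContDiffAt ℝ ∞ (fun z : Coord n × Coord n => f z.1 z.2) z.swap :=
    (continuous_swap.tendsto (v₀, x₀)).eventually hreg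
  have hquad : ∀ᶠ y in 𝓝 v₀, ∀ᶠ x in 𝓝 x₀, ContDiffAt ℝ ∞ (fun x => A x y y) x := by
    filter_upwards [hswap.curry_nhds, isOpen_ne.mem_nhds hv₀] with y hy hy0
    filter_upwards [hy, ha, hA.eventually_nhds] with x hxy hax hAx
    refine ContDiffAt.congr_of_eventuallyEq ?_
      (hAx.mono fun x hx => (hx.dualNormForm_eq hy0).symm)
    exact (contDiffAt_dualNormForm (m := ∞) (z := (x, y)) hxy
      (hAx.self_of_nhds.isMinkowskiNorm.det_gMat_ne_zero hy0) hax).comp x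
      (f := fun x => (x, y)) (contDiffAt_id.prodMk contDiffAt_const)
  refine eventually_all.2 fun i => eventually_all.2 fun j => ?_
  simp only [stdMatrix_apply]
  exact eventually_contDiffAt_apply_of_quadratic (hA.mono fun _ h => h.symm) hquad _ _

/-- The norm `f x` is `e^ρ` times the Finsleroid norm with scalar product `A`, axis `da` and
parameter `g`, and these data depend smoothly on the base point at `x`. -/
structure IsSmoothFinsleroidAt (f : Coord n → Coord n → ℝ) (a : Coord n → ℝ)
    (A : Coord n → LinearMap.BilinForm ℝ (Coord n)) (g ρ : Coord n → ℝ) (x : Coord n) : Prop where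
  contDiffAt_stdMatrix : ∀ i j, ContDiffAt ℝ ∞ (fun x => stdMatrix (A x) i j) x
  contDiffAt_factor : ContDiffAt ℝ ∞ a x
  contDiffAt_parameter : ContDiffAt ℝ ∞ g x
  contDiffAt_exponent : ContDiffAt ℝ ∞ ρ x
  isUnitForm : IsUnitForm (A x) (fderiv ℝ a x)
  parameter_mem : g x ∈ Ioo (-2) 2
  eq_finsleroidNorm : ∀ y, f x y = Real.exp (ρ x) * finsleroidNorm (g x) (A x) (fderiv ℝ a x) y

theorem HasQuadraticDualNorm.isSmoothFinsleroidAt {v : Coord n → Coord n}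
    (h : HasQuadraticDualNorm (f x) (fderiv ℝ a x) (A x))
    (hA : ∀ i j, ContDiffAt ℝ ∞ (fun x => stdMatrix (A x) i j) x) (ha : ContDiffAt ℝ ∞ a x)
    (hf : ContDiffAt ℝ ∞ (fun z : Coord n × Coord n => f z.1 z.2) (x, v x))
    (hv : ContDiffAt ℝ ∞ v x) (hv0 : v x ≠ 0) (hker : fderiv ℝ a x (v x) = 0) :
    IsSmoothFinsleroidAt f a A
      (fun x => axialParameter (f x) (A x) (formGradient (A x) a x) (v x))
      (fun x => conformalExponent (f x) (A x)
        (axialParameter (f x) (A x) (formGradient (A x) a x) (v x)) (v x)) x := by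
  have hU := h.isUnitForm
  have hpos := hU.pos _ hv0
  have hFpos := h.isMinkowskiNorm.pos hv0
  obtain ⟨g, hg, ρ, hF⟩ := h.exists_eq_finsleroidNorm
  have hgx : axialParameter (f x) (A x) (formGradient (A x) a x) (v x) = g :=
    hU.axialParameter_eq hg hF
      ((h.isMinkowskiNorm.contDiffAt _ hv0).differentiableAt two_ne_zero)
      hU.apply_formGradient hU.fderiv_formGradient hv0 hker
  have hsmooth_g := contDiffAt_axialParameter hf hA hv
    (contDiffAt_formGradient hA (det_stdMatrix_ne_zero hU.pos) ha) hpos hFpos.ne'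
  refine ⟨hA, ha, hsmooth_g,
    contDiffAt_conformalExponent hf hA hv hsmooth_g (by rwa [hgx]) hpos hFpos, hU, by rwa [hgx],
    fun y => ?_⟩
  rw [hgx, hU.conformalExponent_eq hF hv0 hker, hF]

theorem exists_isSmoothFinsleroidAt (hn : 3 ≤ n)
    (H : ∀ᶠ x in 𝓝 x₀, IsContractedInvariantAt f a x) (hη : ∀ᶠ x in 𝓝 x₀, fderiv ℝ a x ≠ 0)
    (hv₀ : v₀ ≠ 0) (hηv₀ : fderiv ℝ a x₀ v₀ = 0)
    (hreg : ∀ᶠ z in 𝓝 (x₀, v₀), ContDiffAt ℝ ∞ (fun z : Coord n × Coord n => f z.1 z.2) z) :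
    ∃ (A : Coord n → LinearMap.BilinForm ℝ (Coord n)) (g ρ : Coord n → ℝ),
      ∀ᶠ x in 𝓝 x₀, IsSmoothFinsleroidAt f a A g ρ x := by
  have hex : ∀ x, ∃ A : LinearMap.BilinForm ℝ (Coord n), IsContractedInvariantAt f a x →
      fderiv ℝ a x ≠ 0 → HasQuadraticDualNorm (f x) (fderiv ℝ a x) A := fun x => by
    by_cases hx : IsContractedInvariantAt f a x ∧ fderiv ℝ a x ≠ 0
    · exact (hx.1.exists_hasQuadraticDualNorm hn hx.2).imp fun A hA _ _ => hA
    · exact ⟨0, fun h h' => absurd ⟨h, h'⟩ hx⟩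
  choose A hAspec using hex
  have hA : ∀ᶠ x in 𝓝 x₀, HasQuadraticDualNorm (f x) (fderiv ℝ a x) (A x) := by
    filter_upwards [H, hη] with x hx hηx using hAspec x hx hηx
  have ha := H.mono fun x hx => hx.contDiffAt_factor
  have hcoeff := eventually_contDiffAt_stdMatrix ha hA hv₀ hreg
  -- The parameters are read off at vectors annihilated by `da`; projecting `v₀` along the gradient
  -- of `a` makes a smooth choice of such vectors.
  set v : Coord n → Coord n := fun x => v₀ - fderiv ℝ a x v₀ • formGradient (A x) a x with hvdef
  have hv : ∀ᶠ x in 𝓝 x₀, ContDiffAt ℝ ∞ v x := by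
    filter_upwards [hcoeff, hA, ha] with x hx hAx hax
    exact contDiffAt_const.sub (((hax.fderiv_right (m := ∞) (by simp)).clm_apply
      contDiffAt_const).smul
      (contDiffAt_formGradient hx (det_stdMatrix_ne_zero hAx.isUnitForm.pos) hax))
  have hvx₀ : v x₀ = v₀ := by simp [hvdef, hηv₀]
  have hpair : Tendsto (fun x => (x, v x)) (𝓝 x₀) (𝓝 (x₀, v₀)) := by
    have h : ContinuousAt (fun x => (x, v x)) x₀ :=
      continuousAt_id.prodMk hv.self_of_nhds.continuousAt
    simpa only [ContinuousAt, hvx₀] using h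
  have hv0 : ∀ᶠ x in 𝓝 x₀, v x ≠ 0 :=
    hv.self_of_nhds.continuousAt.eventually_ne (hvx₀.symm ▸ hv₀)
  refine ⟨A, fun x => axialParameter (f x) (A x) (formGradient (A x) a x) (v x),
    fun x => conformalExponent (f x) (A x)
      (axialParameter (f x) (A x) (formGradient (A x) a x) (v x)) (v x), ?_⟩
  filter_upwards [hA, hcoeff, ha, hpair.eventually hreg, hv, hv0] with x hAx hcx hax hfx hvx hvx0
  refine hAx.isSmoothFinsleroidAt hcx hax hfx hvx hvx0 ?_
  simp [hvdef, hAx.isUnitForm.fderiv_formGradient]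

end SmoothFinsleroidData

/-! ### Induced coordinates on the tangent bundle -/

section InducedCoordinates

variable {n : ℕ} {M : Type*} [TopologicalSpace M] [ChartedSpace (Coord n) M]
  {e : OpenPartialHomeomorph M (Coord n)} {x : Coord n} {O : Set (Coord n)}

/-- The components of a tangent vector in the chart `e`; the inverse of `vec`. -/
def components (e : OpenPartialHomeomorph M (Coord n)) (x : M) :
    TangentSpace (𝓡 n) x →ₗ[ℝ] Coord n :=
  (mfderiv (𝓡 n) (𝓡 n) e x).toLinearMap

theorem mdifferentiable_of_mem_maximalAtlas (he : e ∈ IsManifold.maximalAtlas (𝓡 n) ∞ M) :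
    e.MDifferentiable (𝓡 n) (𝓡 n) :=
  ⟨(contMDiffOn_of_mem_maximalAtlas he).mdifferentiableOn (by simp),
    (contMDiffOn_symm_of_mem_maximalAtlas he).mdifferentiableOn (by simp)⟩

theorem vec_components (he : e ∈ IsManifold.maximalAtlas (𝓡 n) ∞ M)
    {v : TangentBundle (𝓡 n) M} (hv : v.proj ∈ e.source) :
    vec e (e v.proj) (components e v.proj v.snd) = v := by
  obtain ⟨x, v⟩ := v
  have hderiv := (mdifferentiable_of_mem_maximalAtlas he).symm_comp_deriv hv
  exact Bundle.TotalSpace.ext (e.left_inv hv) (heq_of_eq (DFunLike.congr_fun hderiv v))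

theorem components_vec (he : e ∈ IsManifold.maximalAtlas (𝓡 n) ∞ M) (hx : x ∈ e.target)
    (y : Coord n) : components e (vec e x y).proj (vec e x y).snd = y :=
  DFunLike.congr_fun ((mdifferentiable_of_mem_maximalAtlas he).comp_symm_deriv hx) y

theorem vec_snd_ne_zero (he : e ∈ IsManifold.maximalAtlas (𝓡 n) ∞ M) (hx : x ∈ e.target)
    {y : Coord n} (hy : y ≠ 0) : (vec e x y).snd ≠ 0 := fun h => hy <| by
  rw [← components_vec he hx y, h, map_zero]

theorem components_injective (he : e ∈ IsManifold.maximalAtlas (𝓡 n) ∞ M) {x : M}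
    (hx : x ∈ e.source) : Function.Injective (components e x) :=
  (mdifferentiable_of_mem_maximalAtlas he).mfderiv_injective hx

theorem components_surjective (he : e ∈ IsManifold.maximalAtlas (𝓡 n) ∞ M) {x : M}
    (hx : x ∈ e.source) : Function.Surjective (components e x) :=
  (mdifferentiable_of_mem_maximalAtlas he).mfderiv_surjective hx

theorem contMDiff_mk_tangentBundle :
    ContMDiff 𝓘(ℝ, Coord n × Coord n) (𝓡 n).tangent ∞
      (fun z : Coord n × Coord n => (⟨z.1, z.2⟩ : TangentBundle (𝓡 n) (Coord n))) := by
  rw [modelWithCornersSelf_prod]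
  exact contMDiff_tangentBundleModelSpaceHomeomorph_symm (I := 𝓡 n)

theorem contMDiff_proj_snd_tangentBundle :
    ContMDiff (𝓡 n).tangent 𝓘(ℝ, Coord n × Coord n) ∞
      (fun v : TangentBundle (𝓡 n) (Coord n) => ((v.proj, v.snd) : Coord n × Coord n)) := by
  rw [modelWithCornersSelf_prod]
  exact contMDiff_tangentBundleModelSpaceHomeomorph (I := 𝓡 n)

theorem contMDiffOn_comp_chart (he : e ∈ IsManifold.maximalAtlas (𝓡 n) ∞ M) {u : Coord n → ℝ}
    (hu : ∀ x ∈ O, ContDiffAt ℝ ∞ u x) :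
    ContMDiffOn (𝓡 n) 𝓘(ℝ, ℝ) ∞ (fun x => u (e x)) (e.source ∩ e ⁻¹' O) := fun x hx =>
  ((hu (e x) hx.2).contMDiffAt.comp x ((contMDiffOn_of_mem_maximalAtlas he).contMDiffAt
    (e.open_source.mem_nhds hx.1))).contMDiffWithinAt

theorem contDiffAt_comp_symm {α : M → ℝ} (hα : ContMDiff (𝓡 n) 𝓘(ℝ, ℝ) ∞ α)
    (he : e ∈ IsManifold.maximalAtlas (𝓡 n) ∞ M) (hx : x ∈ e.target) :
    ContDiffAt ℝ ∞ (fun x => α (e.symm x)) x :=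
  (hα.contMDiffAt.comp x ((contMDiffOn_symm_of_mem_maximalAtlas he).contMDiffAt
    (e.open_target.mem_nhds hx))).contDiffAt

theorem fderiv_comp_symm_ne_zero {α : M → ℝ} (hα : ContMDiff (𝓡 n) 𝓘(ℝ, ℝ) ∞ α)
    (he : e ∈ IsManifold.maximalAtlas (𝓡 n) ∞ M) {p : M} (hpe : p ∈ e.source)
    (hp : mfderiv (𝓡 n) 𝓘(ℝ, ℝ) α p ≠ 0) : fderiv ℝ (fun x => α (e.symm x)) (e p) ≠ 0 := by
  refine fun h => hp ?_
  have hfactor : α =ᶠ[𝓝 p] (fun x => α (e.symm x)) ∘ e := by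
    filter_upwards [e.open_source.mem_nhds hpe] with q hq
    rw [Function.comp_apply, e.left_inv hq]
  have hdiff : MDifferentiableAt (𝓡 n) 𝓘(ℝ, ℝ) (fun x => α (e.symm x)) (e p) :=
    ((contDiffAt_comp_symm hα he (e.map_source hpe)).differentiableAt (by simp)).mdifferentiableAt
  rw [hfactor.mfderiv_eq, mfderiv_comp p hdiff
    ((mdifferentiable_of_mem_maximalAtlas he).mdifferentiableAt hpe), mfderiv_eq_fderiv, h]
  exact ContinuousLinearMap.zero_comp _

variable [IsManifold (𝓡 n) ∞ M]

theorem contMDiffAt_vec (he : e ∈ IsManifold.maximalAtlas (𝓡 n) ∞ M) (hx : x ∈ e.target)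
    (y : Coord n) :
    ContMDiffAt 𝓘(ℝ, Coord n × Coord n) (𝓡 n).tangent ∞
      (fun z : Coord n × Coord n => vec e z.1 z.2) (x, y) := by
  have : IsManifold (𝓡 n) 1 M := IsManifold.of_le (n := ∞) (by simp)
  have hsymm := contMDiffOn_symm_of_mem_maximalAtlas he
  have hopen : IsOpen {z : Coord n × Coord n | z.1 ∈ e.target} :=
    e.open_target.preimage continuous_fst
  have htangent := (hsymm.contMDiffOn_tangentMapWithin (m := ∞) (by simp)
    e.open_target.uniqueMDiffOn).comp (t := _) (s := {z : Coord n × Coord n | z.1 ∈ e.target})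
    contMDiff_mk_tangentBundle.contMDiffOn fun z hz => hz
  refine (htangent.congr fun z hz => ?_).contMDiffAt (hopen.mem_nhds hx)
  exact (tangentMapWithin_eq_tangentMap (p := (⟨z.1, z.2⟩ : TangentBundle (𝓡 n) (Coord n)))
    (e.open_target.uniqueMDiffOn _ hz)
    ((hsymm.contMDiffAt (e.open_target.mem_nhds hz)).mdifferentiableAt (by simp))).symm

theorem contMDiffAt_components (he : e ∈ IsManifold.maximalAtlas (𝓡 n) ∞ M)
    {v : TangentBundle (𝓡 n) M} (hv : v.proj ∈ e.source) :
    ContMDiffAt (𝓡 n).tangent 𝓘(ℝ, Coord n × Coord n) ∞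
      (fun v : TangentBundle (𝓡 n) M => (e v.proj, components e v.proj v.snd)) v := by
  have : IsManifold (𝓡 n) 1 M := IsManifold.of_le (n := ∞) (by simp)
  have hchart := contMDiffOn_of_mem_maximalAtlas he
  have hopen : IsOpen {v : TangentBundle (𝓡 n) M | v.proj ∈ e.source} :=
    e.open_source.preimage (FiberBundle.continuous_proj _ _)
  have htangent := contMDiff_proj_snd_tangentBundle.comp_contMDiffOn
    (hchart.contMDiffOn_tangentMapWithin (m := ∞) (by simp) e.open_source.uniqueMDiffOn)
  refine (htangent.congr fun w hw => ?_).contMDiffAt (hopen.mem_nhds hv)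
  have hmap := tangentMapWithin_eq_tangentMap (p := w) (e.open_source.uniqueMDiffOn _ hw)
    ((hchart.contMDiffAt (e.open_source.mem_nhds hw)).mdifferentiableAt (by simp))
  exact (congrArg (fun v : TangentBundle (𝓡 n) (Coord n) => ((v.proj, v.snd) : Coord n × Coord n))
    hmap).symm

theorem contMDiffOn_comp_components (he : e ∈ IsManifold.maximalAtlas (𝓡 n) ∞ M)
    {u : Coord n × Coord n → ℝ} (hu : ∀ x ∈ O, ∀ y, ContDiffAt ℝ ∞ u (x, y)) :
    ContMDiffOn (𝓡 n).tangent 𝓘(ℝ, ℝ) ∞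
      (fun v : TangentBundle (𝓡 n) M => u (e v.proj, components e v.proj v.snd))
      {v | v.proj ∈ e.source ∩ e ⁻¹' O} := fun v hv =>
  (ContMDiffAt.comp v (hu _ hv.2 _).contMDiffAt
    (contMDiffAt_components he hv.1)).contMDiffWithinAt

end InducedCoordinates

section FinslerInChart

variable {n : ℕ} {M : Type*} [TopologicalSpace M] [ChartedSpace (Coord n) M]
  [IsManifold (𝓡 n) ∞ M] {e : OpenPartialHomeomorph M (Coord n)}
  {F : TangentBundle (𝓡 n) M → ℝ} {α : M → ℝ} {x y : Coord n}

theorem IsRegularVec.eventually_contDiffAt_inChart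
    (he : e ∈ IsManifold.maximalAtlas (𝓡 n) ∞ M) (hx : x ∈ e.target)
    (hreg : IsRegularVec F (vec e x y)) :
    ∀ᶠ z in 𝓝 (x, y), ContDiffAt ℝ ∞ (fun z : Coord n × Coord n => inChart F e z.1 z.2) z := by
  have htarget : ∀ᶠ z : Coord n × Coord n in 𝓝 (x, y), z.1 ∈ e.target :=
    (e.open_target.preimage continuous_fst).mem_nhds hx
  filter_upwards [(contMDiffAt_vec he hx y).continuousAt.eventually hreg.2, htarget] with z hFz hz
  exact (hFz.comp z (contMDiffAt_vec he hz z.2)).contDiffAt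

namespace IsFinsler

theorem contDiffAt_inChart_two (hF : IsFinsler F) (he : e ∈ IsManifold.maximalAtlas (𝓡 n) ∞ M)
    (hx : x ∈ e.target) (hy : y ≠ 0) :
    ContDiffAt ℝ 2 (fun z : Coord n × Coord n => inChart F e z.1 z.2) (x, y) := by
  have hopen : IsOpen {z : Coord n × Coord n | z.1 ∈ e.target ∧ z.2 ≠ 0} :=
    (e.open_target.preimage continuous_fst).inter (isOpen_ne.preimage continuous_snd)
  have hvec : ContMDiffOn 𝓘(ℝ, Coord n × Coord n) (𝓡 n).tangent 2
      (fun z : Coord n × Coord n => vec e z.1 z.2) {z | z.1 ∈ e.target ∧ z.2 ≠ 0} := fun z hz =>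
    (contMDiffAt_infty.1 (contMDiffAt_vec he hz.1 z.2) 2).contMDiffWithinAt
  have hcomp := hF.contMDiffOn_two.comp hvec fun z hz => vec_snd_ne_zero he hz.1 hz.2
  exact (hcomp.contMDiffAt (hopen.mem_nhds ⟨hx, hy⟩)).contDiffAt

theorem inChart_smul (hF : IsFinsler F) (x y : Coord n) {t : ℝ} (ht : 0 < t) :
    inChart F e x (t • y) = t * inChart F e x y := by
  have hlin := (mfderiv (𝓡 n) (𝓡 n) e.symm x).map_smul t y
  exact (congrArg (fun v : TangentSpace (𝓡 n) (e.symm x) => F ⟨e.symm x, v⟩) hlin).trans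
    (hF.homogeneous (e.symm x) _ t ht)

theorem isMinkowskiNorm_inChart (hF : IsFinsler F) (he : e ∈ IsManifold.maximalAtlas (𝓡 n) ∞ M)
    (hx : x ∈ e.target) : IsMinkowskiNorm (inChart F e x) where
  nonneg _ := hF.nonneg _
  smul y _ ht := hF.inChart_smul x y ht
  contDiffAt _ hy := contDiffAt_slice (hF.contDiffAt_inChart_two he hx hy)
  posDef y hy _ hX := fundamentalTensor_self_pos
    (contDiffAt_slice (hF.contDiffAt_inChart_two he hx hy)) (hF.posDef e he x hx y hy) hX

theorem exists_isRegularVec_of_notMem_span (hF : IsFinsler F)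
    (he : e ∈ IsManifold.maximalAtlas (𝓡 n) ∞ M) (hx : x ∈ e.target) :
    ∃ d : Coord n, ∀ y, y ∉ Submodule.span ℝ {d} → IsRegularVec F (vec e x y) := by
  obtain ⟨d, hd⟩ := hF.regular (e.symm x)
  refine ⟨components e (e.symm x) d, fun y hy => hd _ fun hmem => hy ?_⟩
  obtain ⟨t, ht⟩ := Submodule.mem_span_singleton.1 hmem
  refine Submodule.mem_span_singleton.2 ⟨t, ?_⟩
  rw [← map_smul, ht]
  exact components_vec he hx y

theorem isContractedInvariantAt_inChart (hF : IsFinsler F)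
    (hα : ContMDiff (𝓡 n) 𝓘(ℝ, ℝ) ∞ α) (hP : ContractedBerwaldInvariant F α)
    (he : e ∈ IsManifold.maximalAtlas (𝓡 n) ∞ M) (hx : x ∈ e.target) :
    IsContractedInvariantAt (inChart F e) (fun x => α (e.symm x)) x where
  isMinkowskiNorm := hF.isMinkowskiNorm_inChart he hx
  contDiffAt_two _ hy := hF.contDiffAt_inChart_two he hx hy
  contDiffAt_factor := contDiffAt_comp_symm hα he hx
  invariant := (hF.exists_isRegularVec_of_notMem_span he hx).imp fun _ hd y hy =>
    ⟨((hd y hy).eventually_contDiffAt_inChart he hx).self_of_nhds, hP e he x hx y (hd y hy)⟩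

end IsFinsler

/-- The function on the tangent bundle which in the chart `e` consists of the Finsleroid norms with
scalar product `A x`, axis `d_x a` and parameter `g x`. -/
def finsleroidOfChart (e : OpenPartialHomeomorph M (Coord n))
    (A : Coord n → LinearMap.BilinForm ℝ (Coord n)) (a g : Coord n → ℝ)
    (v : TangentBundle (𝓡 n) M) : ℝ :=
  finsleroidNorm (g (e v.proj)) (A (e v.proj)) (fderiv ℝ a (e v.proj))
    (components e v.proj v.snd)

variable {A : Coord n → LinearMap.BilinForm ℝ (Coord n)} {f : Coord n → Coord n → ℝ}
  {a g ρ : Coord n → ℝ} {O : Set (Coord n)}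

theorem isRiemannianOn_compl₁₂_components (he : e ∈ IsManifold.maximalAtlas (𝓡 n) ∞ M)
    (hsymm : ∀ x ∈ O, ∀ v w, A x v w = A x w v) (hpos : ∀ x ∈ O, ∀ y, y ≠ 0 → 0 < A x y y)
    (hA : ∀ x ∈ O, ∀ i j, ContDiffAt ℝ ∞ (fun x => stdMatrix (A x) i j) x) :
    IsRiemannianOn (e.source ∩ e ⁻¹' O)
      fun x => (A (e x)).compl₁₂ (components e x) (components e x) where
  symm x hx _ _ := hsymm (e x) hx.2 _ _
  pos x hx _ hv := hpos (e x) hx.2 _ <|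
    (map_ne_zero_iff (components e x) (components_injective he hx.1)).2 hv
  smooth := contMDiffOn_comp_components he (u := fun z => A z.1 z.2 z.2) fun x hx y =>
    contDiffAt_bilinForm_apply (A := fun z : Coord n × Coord n => A z.1)
      (fun i j => (hA x hx i j).comp (x, y) contDiffAt_fst) contDiffAt_snd contDiffAt_snd

theorem isFinsleroidOn_finsleroidOfChart (he : e ∈ IsManifold.maximalAtlas (𝓡 n) ∞ M)
    (h : ∀ x ∈ O, IsSmoothFinsleroidAt f a A g ρ x) :
    IsFinsleroidOn (e.source ∩ e ⁻¹' O) (finsleroidOfChart e A a g) := by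
  refine ⟨fun x => (A (e x)).compl₁₂ (components e x) (components e x),
    fun x => (fderiv ℝ a (e x)).toLinearMap ∘ₗ components e x, fun x => g (e x),
    isRiemannianOn_compl₁₂_components he (fun x hx => (h x hx).isUnitForm.symm)
      (fun x hx => (h x hx).isUnitForm.pos) (fun x hx => (h x hx).contDiffAt_stdMatrix),
    ?_, fun x hx => ?_, contMDiffOn_comp_chart he fun x hx => (h x hx).contDiffAt_parameter,
    fun x hx => (h (e x) hx.2).parameter_mem, fun _ _ => ?_⟩
  · refine contMDiffOn_comp_components he (u := fun z => fderiv ℝ a z.1 z.2) fun x hx y => ?_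
    exact (((h x hx).contDiffAt_factor.fderiv_right (m := ∞) (by simp)).comp (x, y)
      contDiffAt_fst).clm_apply contDiffAt_snd
  · obtain ⟨w, hw, hw_unit⟩ := (h (e x) hx.2).isUnitForm.exists_dual
    obtain ⟨u, rfl⟩ := components_surjective he hx.1 w
    exact ⟨u, fun v => hw (components e x v), hw_unit⟩
  · simp only [finsleroidOfChart, finsleroidNorm, transverseForm_apply, ← pow_two]
    rfl

theorem locallyConformalToFinsleroidAt_of_isSmoothFinsleroidAt {p : M}
    (he : e ∈ IsManifold.maximalAtlas (𝓡 n) ∞ M) (hp : p ∈ e.source)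
    (h : ∀ᶠ x in 𝓝 (e p), IsSmoothFinsleroidAt (inChart F e) a A g ρ x) :
    LocallyConformalToFinsleroidAt F p := by
  obtain ⟨O, hO, hO_open, hpO⟩ := eventually_nhds_iff.1 h
  refine ⟨e.source ∩ e ⁻¹' O, e.isOpen_inter_preimage hO_open, ⟨hp, hpO⟩, fun x => ρ (e x),
    finsleroidOfChart e A a g, contMDiffOn_comp_chart he fun x hx => (hO x hx).contDiffAt_exponent,
    isFinsleroidOn_finsleroidOfChart he hO, fun v hv => ?_⟩
  have heq := (hO (e v.proj) hv.2).eq_finsleroidNorm (components e v.proj v.snd)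
  rwa [inChart, vec_components he hv.1] at heq

end FinslerInChart

theorem exists_mem_ker_notMem_span {n : ℕ} (hn : 3 ≤ n) (η : Coord n →L[ℝ] ℝ) (d : Coord n) :
    ∃ v, η v = 0 ∧ v ∉ Submodule.span ℝ {d} := by
  by_contra! h
  have hker := Submodule.finrank_mono (s := LinearMap.ker η.toLinearMap)
    (t := Submodule.span ℝ {d}) fun v hv => h v hv
  have hline : Module.finrank ℝ (Submodule.span ℝ {d}) ≤ 1 :=
    (finrank_span_le_card ({d} : Set (Coord n))).trans (by simp)
  have hrange : Module.finrank ℝ (LinearMap.range η.toLinearMap) ≤ 1 := by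
    simpa using Submodule.finrank_le (LinearMap.range η.toLinearMap)
  have hsum := LinearMap.finrank_range_add_finrank_ker η.toLinearMap
  rw [finrank_euclideanSpace_fin] at hsum
  omega

end FinslerConformal

end

open FinslerConformal in
theorem theoremB_general {n : ℕ} (hn : 3 ≤ n) {M : Type*} [TopologicalSpace M]
    [ChartedSpace (Coord n) M] [IsManifold (𝓡 n) ∞ M]
    (F : TangentBundle (𝓡 n) M → ℝ) (hF : IsFinsler F)
    (α : M → ℝ) (hα : ContMDiff (𝓡 n) 𝓘(ℝ, ℝ) ∞ α)
    (p : M) (hp : mfderiv (𝓡 n) 𝓘(ℝ, ℝ) α p ≠ 0)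
    (hP : ContractedBerwaldInvariant F α) :
    LocallyConformalToFinsleroidAt F p := by
  set e := chartAt (Coord n) p
  have he : e ∈ IsManifold.maximalAtlas (𝓡 n) ∞ M := IsManifold.chart_mem_maximalAtlas p
  have hpe : p ∈ e.source := mem_chart_source _ p
  have hxe : e p ∈ e.target := e.map_source hpe
  have hη : ∀ᶠ x in 𝓝 (e p), fderiv ℝ (fun x => α (e.symm x)) x ≠ 0 :=
    ((contDiffAt_comp_symm hα he hxe).fderiv_right (m := 0) (by simp)).continuousAt.eventually_ne
      (fderiv_comp_symm_ne_zero hα he hpe hp)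
  have hinv := (e.open_target.eventually_mem hxe).mono fun x hx =>
    hF.isContractedInvariantAt_inChart hα hP he hx
  obtain ⟨d, hd⟩ := hF.exists_isRegularVec_of_notMem_span he hxe
  obtain ⟨v₀, hv₀, hv₀d⟩ := exists_mem_ker_notMem_span hn (fderiv ℝ (fun x => α (e.symm x)) (e p)) d
  have hv₀_ne : v₀ ≠ 0 := fun h => hv₀d (h ▸ Submodule.zero_mem _)
  obtain ⟨A, g, ρ, hdata⟩ := exists_isSmoothFinsleroidAt hn hinv hη hv₀_ne hv₀
    ((hd v₀ hv₀d).eventually_contDiffAt_inChart he hxe)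
  exact locallyConformalToFinsleroidAt_of_isSmoothFinsleroidAt he hpe hdata

theorem theoremB {n : ℕ} (hn : 3 ≤ n) {M : Type*} [TopologicalSpace M]
    [ChartedSpace (FinslerConformal.Coord n) M] [IsManifold (𝓡 n) ∞ M]
    (F : TangentBundle (𝓡 n) M → ℝ) (hF : FinslerConformal.IsFinsler F)
    (α : M → ℝ) (hα : ContMDiff (𝓡 n) 𝓘(ℝ, ℝ) ∞ α)
    (p : M) (hp : mfderiv (𝓡 n) 𝓘(ℝ, ℝ) α p ≠ 0)
    (hcurv : FinslerConformal.IndicatrixPosCurvAt F p)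
    (hP : FinslerConformal.ContractedBerwaldInvariant F α) :
    FinslerConformal.LocallyConformalToFinsleroidAt F p ∨
      FinslerConformal.LocallyRiemannianAt F p :=
  Or.inl (theoremB_general hn F hF α hα p hp hP)
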